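/- Let $n\ge 2$ be an integer, $1<p<n$, $p^*=\frac{np}{n-p}$ and $q\ge p^*-1$. Let $\mathbb{M}^n$ be a Cartan-Hadamard model manifold: it has a pole $o$ such that, in global polar coordinates $(r,\theta)\in(0,\infty)\times\mathbb{S}^{n-1}$ about $o$, its metric is $g=dr^2+\psi^2(r)\,g_{\mathbb{S}^{n-1}}$, where $\psi:[0,\infty)\to[0,\infty)$ is regular ($C^2$ up to $0$) and convex, with $\psi(0)=0$ and $\psi'(0)=1$. Set $$\Theta(r)=\frac{\int_0^r\psi^{n-1}\,ds}{\psi^{n-1}(r)},\qquad r>0 .$$ A radial solution is a function $u=u(r)\in W^{1,p}_{\rm loc}(\mathbb{M}^n)\cap L^\infty_{\rm loc}(\mathbb{M}^n)$, depending only on $r=\mathrm{dist}(\cdot,o)$, which is a weak solution of $$-\Delta_p u=u^q,\qquad u>0,\qquad\text{on }\mathbb{M}^n ,\qquad \Delta_p u=\mathrm{div}\big(|\nabla u|^{p-2}\nabla u\big).$$ Let $u$ be a radial solution. Then $u$ has a representative that is a continuous function of $r\in[0,\infty)$, for which the following hold. (i) Suppose that $\Theta^{\frac1{p-1}}\notin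 L^1(0,\infty)$ ($p$-stochastic completeness), and that either there exists $\gamma\in[0,1)$ such that $$\lim_{r\to+\infty}\frac{r^\gamma\,\psi'(r)}{\psi(r)}=:\ell\in(0,+\infty),$$ or $$\lim_{r\to+\infty}\frac{\psi'(r)}{\psi(r)}=+\infty\qquad\text{and}\qquad\lim_{r\to+\infty}\frac{\psi(r)}{\psi'(r)}\left[\log\left(\frac{\psi'(r)}{\psi(r)}\right)\right]'=0 .$$ Then $$\lim_{r\to+\infty}\left(\int_0^r\Theta^{\frac1{p-1}}\,ds\right)^{\frac{p-1}{q+1-p}}u(r)=\left(\frac{p-1}{q+1-p}\right)^{\frac{p-1}{q+1-p}} .$$ (ii) Suppose that $\Theta^{\frac1{p-1}}\in L^1(0,\infty)$ ($p$-stochastic incompleteness). Then the limit $\lambda:=\lim_{r\to+\infty}u(r)$ exists and is positive and finite, $$\lim_{r\to+\infty}\left(\int_r^{+\infty}\Theta^{\frac1{p-1}}\,ds\right)^{-1}\big(u(r)-\lambda\big)=\lambda^{\frac{q}{p-1}},$$ and $$\lambda\le\left(\frac{p-1}{q+1-p}\right)^{\frac{p-1}{q+1-p}}\left(\int_0^{+\infty}\Theta^{\frac1{p-1}}\,ds\right)^{-\frac{p-1}{q+1-p}}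 .$$ -/

import Mathlib

open MeasureTheory Set Filter Topology
open scoped ContDiff

noncomputable section

namespace ModelManifold

/-- The model functions `ψ : [0,∞) → [0,∞)` of Cartan-Hadamard model manifolds: `ψ` is regular
(`C²` up to `0`) and convex, `ψ(0) = 0`, `ψ'(0) = 1`. Only the values of `ψ` on `[0,∞)` matter;
positivity on `(0,∞)` follows from the other properties. -/
structure IsCartanHadamardModel (ψ : ℝ → ℝ) : Prop where
  contDiffOn : ContDiffOn ℝ 2 ψ (Ici 0)
  map_zero : ψ 0 = 0
  hasDerivWithinAt_zero : HasDerivWithinAt ψ 1 (Ici 0) 0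
  convexOn : ConvexOn ℝ (Ici 0) ψ

/-- The underlying manifold, in global normal coordinates `x = r θ` about the pole `o = 0`:
`r = ‖x‖` is the Riemannian distance from the pole and `θ = x / ‖x‖` lies on the unit sphere. -/
abbrev Space (n : ℕ) : Type := EuclideanSpace ℝ (Fin n)

variable {n : ℕ}

/-- The ratio `ψ(r) / r` at `r = ‖x‖`, with its limit value `ψ'(0) = 1` at the pole. -/
def warp (ψ : ℝ → ℝ) (x : Space n) : ℝ :=
  open Classical in if x = 0 then 1 else ψ ‖x‖ / ‖x‖

/-- The Riemannian metric `dr² + ψ(r)² g_S` at the point `x`, where `g_S` is the round metric of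
the unit sphere. A vector `v` has radial component `⟪x/‖x‖, v⟫`, and its part orthogonal to the
radius has length `ψ(r)/r` times the Euclidean one. At the pole it is the Euclidean product. -/
def metric (ψ : ℝ → ℝ) (x v w : Space n) : ℝ :=
  inner ℝ (‖x‖⁻¹ • x) v * inner ℝ (‖x‖⁻¹ • x) w
    + warp ψ x ^ 2 * (inner ℝ v w - inner ℝ (‖x‖⁻¹ • x) v * inner ℝ (‖x‖⁻¹ • x) w)

/-- The length of the tangent vector `v` at `x`. -/
def metricNorm (ψ : ℝ → ℝ) (x v : Space n) : ℝ := Real.sqrt (metric ψ x v v)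

/-- The Riemannian volume `ψ(r)^(n-1) dr dθ`, that is `(ψ(r)/r)^(n-1) dx`. -/
def vol (n : ℕ) (ψ : ℝ → ℝ) : Measure (Space n) :=
  (volume : Measure (Space n)).withDensity fun x => ENNReal.ofReal (warp ψ x ^ (n - 1))

/-- The vector field `G` is the weak (Riemannian) gradient of `u`: the 1-form `g(G, ·)` is the
distributional differential of `u`. -/
def IsWeakGradient (ψ : ℝ → ℝ) (u : Space n → ℝ) (G : Space n → Space n) : Prop :=
  ∀ φ : Space n → ℝ, ContDiff ℝ ∞ φ → HasCompactSupport φ → ∀ v : Space n,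
    ∫ x, u x * fderiv ℝ φ x v = - ∫ x, metric ψ x (G x) v * φ x

/-- `u ∈ W^{1,p}_loc ∩ L^∞_loc`, with weak gradient `G`. -/
structure IsLocalSobolev (ψ : ℝ → ℝ) (p : ℝ) (u : Space n → ℝ) (G : Space n → Space n) :
    Prop where
  aestronglyMeasurable : AEStronglyMeasurable u (vol n ψ)
  aestronglyMeasurable_grad : AEStronglyMeasurable G (vol n ψ)
  isWeakGradient : IsWeakGradient ψ u G
  memLp : ∀ K : Set (Space n), IsCompact K →
    MemLp u (ENNReal.ofReal p) ((vol n ψ).restrict K)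
  memLp_grad : ∀ K : Set (Space n), IsCompact K →
    MemLp (fun x => metricNorm ψ x (G x)) (ENNReal.ofReal p) ((vol n ψ).restrict K)
  bounded : ∀ K : Set (Space n), IsCompact K →
    ∃ C : ℝ, ∀ᵐ x ∂((vol n ψ).restrict K), |u x| ≤ C

/-- Radial solutions: radial (a.e.) weak solutions of `-Δ_p u = u^q`, `u > 0`, on the model
manifold, in `W^{1,p}_loc ∩ L^∞_loc`. Here `dφ(∇u) = g(∇u, ∇φ)`. -/
structure IsRadialSolution (ψ : ℝ → ℝ) (p q : ℝ) (u : Space n → ℝ) : Prop where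
  radial : ∃ f : ℝ → ℝ, ∀ᵐ x ∂(vol n ψ), u x = f ‖x‖
  pos : ∀ᵐ x ∂(vol n ψ), 0 < u x
  weak : ∃ G : Space n → Space n, IsLocalSobolev ψ p u G ∧
    ∀ φ : Space n → ℝ, ContDiff ℝ ∞ φ → HasCompactSupport φ →
      ∫ x, metricNorm ψ x (G x) ^ (p - 2) * fderiv ℝ φ x (G x) ∂(vol n ψ)
        = ∫ x, u x ^ q * φ x ∂(vol n ψ)

/-- `f` is the continuous radial profile of `u`: `u(x) = f(r(x))` for a.e. `x`, with `f`
continuous on `[0,∞)`. -/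
def IsRadialProfile (ψ : ℝ → ℝ) (u : Space n → ℝ) (f : ℝ → ℝ) : Prop :=
  ContinuousOn f (Ici 0) ∧ ∀ᵐ x ∂(vol n ψ), u x = f ‖x‖

/-- The volume-surface ratio `Θ(r) = ψ(r)^(1-n) ∫_0^r ψ^(n-1)`. -/
def Theta (n : ℕ) (ψ : ℝ → ℝ) (r : ℝ) : ℝ :=
  (∫ s in (0 : ℝ)..r, ψ s ^ (n - 1)) / ψ r ^ (n - 1)

/-- `p`-stochastic incompleteness: `Θ^(1/(p-1)) ∈ L¹(0,∞)`. -/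
def PStochasticallyIncomplete (n : ℕ) (ψ : ℝ → ℝ) (p : ℝ) : Prop :=
  IntegrableOn (fun r => Theta n ψ r ^ (1 / (p - 1))) (Ioi 0)

/-- `p`-stochastic completeness: `Θ^(1/(p-1)) ∉ L¹(0,∞)`. -/
def PStochasticallyComplete (n : ℕ) (ψ : ℝ → ℝ) (p : ℝ) : Prop :=
  ¬ IntegrableOn (fun r => Theta n ψ r ^ (1 / (p - 1))) (Ioi 0)

/-- For some `γ ∈ [0,1)`, `r^γ ψ'(r)/ψ(r)` has a limit in `(0,∞)`. -/
def StretchedExponentialGrowth (ψ : ℝ → ℝ) : Prop :=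
  ∃ γ : ℝ, 0 ≤ γ ∧ γ < 1 ∧ ∃ ℓ : ℝ, 0 < ℓ ∧
    Tendsto (fun r => r ^ γ * deriv ψ r / ψ r) atTop (𝓝 ℓ)

/-- `ψ'/ψ → ∞` and `(ψ/ψ') [log (ψ'/ψ)]' → 0`. -/
def SuperExponentialGrowth (ψ : ℝ → ℝ) : Prop :=
  Tendsto (fun r => deriv ψ r / ψ r) atTop atTop ∧
    Tendsto (fun r => ψ r / deriv ψ r * deriv (fun s => Real.log (deriv ψ s / ψ s)) r)
      atTop (𝓝 0)

end ModelManifold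

end

noncomputable section

/-! ### Calculus on the half line -/

section HalfLine

variable {h : ℝ → ℝ}

/-! Write `S = ψ^(n-1)`, `V = ∫₀ʳ S`, `m = ∫₀ʳ S f^q`, `I = ∫₀ʳ Θ^(1/(p-1))`, `α = (q+1-p)/(p-1)`,
so that `Θ = V/S`. A radial solution satisfies `f' = -(m/S)^(1/(p-1))`, which factors as
`-Θ^(1/(p-1)) (m/V)^(1/(p-1))`. Hence `(f^(-α))' = α (m/(V f^q))^(1/(p-1)) I'`, and everything
depends on comparing `m` with `V f^q`. Since `f` decreases, `m ≥ V f^q`, which already gives `f^(-α)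
≥ α I` and the upper bound for the limit.

The opposite control comes from a Pohozaev functional (`pohozaev`). Convexity of `ψ` gives `Θ ψ'/ψ ≥
1/n`, and together with `q + 1 ≥ p*` this makes the functional nonincreasing. Consequently `Z = f
(V/m)^(1/(p-1))` satisfies `Z' ≥ ((q+1-p)/p) I'` (`exists_hasDerivAt_mul_rpow`), while `|f'|/f =
I'/Z`.

If `I` is bounded, monotonicity of `Z` makes `|f'|/f` integrable, so the limit `λ` is positive; then
`m/V → λ^q`, and l'Hôpital's rule gives the rate.

If `I → ∞`, the growth conditions yield `Θ' → 0`, so `Θ |f'|/f ≤ C Θ^(1+1/(p-1))/I → 0`. This makes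
`V f^q` and `m` have asymptotically equal derivatives. Since `m → ∞`, it follows that `V f^q/m → 1`,
and then `f^(-α)/I → α`.

It remains to pass from weak solutions to the integrated equation. Radial mollification shows that
the gradient is radial. Testing with radial functions identifies the flux `S |g|^(p-2) g = -m`
almost everywhere. The resulting slope is continuous, and `u` differs from its radial primitive by a
constant (`exists_isRadialODESolution`). -/

theorem ContinuousOn.intervalIntegrable_of_Ici (hh : ContinuousOn h (Ici 0)) {a b : ℝ}
    (ha : 0 ≤ a) (hb : 0 ≤ b) : IntervalIntegrable h volume a b :=
  (hh.mono fun _ hx => (le_min ha hb).trans hx.1).intervalIntegrable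

theorem integral_comp_max_zero (h : ℝ → ℝ) {r : ℝ} (hr : 0 ≤ r) :
    ∫ s in (0 : ℝ)..r, h (max 0 s) = ∫ s in (0 : ℝ)..r, h s := by
  refine intervalIntegral.integral_congr fun s hs => ?_
  rw [uIcc_of_le hr] at hs
  simp [max_eq_right hs.1]

theorem ContinuousOn.comp_max_zero (hh : ContinuousOn h (Ici 0)) :
    Continuous fun s => h (max 0 s) :=
  hh.comp_continuous (by fun_prop) fun _ => mem_Ici.2 (le_max_left _ _)

theorem ContinuousOn.continuousOn_primitive_Ici (hh : ContinuousOn h (Ici 0)) :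
    ContinuousOn (fun r => ∫ s in (0 : ℝ)..r, h s) (Ici 0) := by
  have : Continuous fun r => ∫ s in (0 : ℝ)..r, h (max 0 s) :=
    intervalIntegral.continuous_primitive (fun _ _ => hh.comp_max_zero.intervalIntegrable _ _) 0
  exact this.continuousOn.congr fun r hr => (integral_comp_max_zero h hr).symm

theorem ContinuousOn.hasDerivAt_primitive_Ici (hh : ContinuousOn h (Ici 0)) {r : ℝ}
    (hr : 0 < r) : HasDerivAt (fun r => ∫ s in (0 : ℝ)..r, h s) (h r) r := by
  have := hh.comp_max_zero.integral_hasStrictDerivAt 0 r |>.hasDerivAt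
  rw [max_eq_right hr.le] at this
  refine this.congr_of_eventuallyEq ?_
  filter_upwards [lt_mem_nhds hr] with s hs
  exact (integral_comp_max_zero h hs.le).symm

theorem monotoneOn_Ioi_of_hasDerivAt_nonneg {a : ℝ} {f f' : ℝ → ℝ}
    (hf : ∀ r, a < r → HasDerivAt f (f' r) r) (hf' : ∀ r, a < r → 0 ≤ f' r) :
    MonotoneOn f (Ioi a) := by
  refine monotoneOn_of_hasDerivWithinAt_nonneg (convex_Ioi a)
    (fun r hr => (hf r hr).continuousAt.continuousWithinAt) (f' := f') ?_ ?_
  · intro r hr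
    rw [interior_Ioi] at hr
    exact (hf r hr).hasDerivWithinAt
  · intro r hr
    rw [interior_Ioi] at hr
    exact hf' r hr

theorem monotoneOn_Ici_of_hasDerivAt_nonneg {a : ℝ} {f f' : ℝ → ℝ} (hc : ContinuousOn f (Ici a))
    (hf : ∀ r, a < r → HasDerivAt f (f' r) r) (hf' : ∀ r, a < r → 0 ≤ f' r) :
    MonotoneOn f (Ici a) := by
  refine monotoneOn_of_hasDerivWithinAt_nonneg (convex_Ici a) hc (f' := f') ?_ ?_
  · intro r hr
    rw [interior_Ici] at hr
    exact (hf r hr).hasDerivWithinAt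
  · intro r hr
    rw [interior_Ici] at hr
    exact hf' r hr

theorem antitoneOn_Ici_of_hasDerivAt_nonpos {a : ℝ} {f f' : ℝ → ℝ} (hc : ContinuousOn f (Ici a))
    (hf : ∀ r, a < r → HasDerivAt f (f' r) r) (hf' : ∀ r, a < r → f' r ≤ 0) :
    AntitoneOn f (Ici a) := by
  have := monotoneOn_Ici_of_hasDerivAt_nonneg (f := fun r => -f r) hc.neg
    (fun r hr => (hf r hr).neg) (fun r hr => neg_nonneg.2 (hf' r hr))
  intro x hx y hy hxy
  exact neg_le_neg_iff.1 (this hx hy hxy)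

/-- One-sided l'Hôpital rule for `∞/∞`. -/
theorem eventually_div_le_of_deriv_le {f g f' g' : ℝ → ℝ} {L M : ℝ} (hLM : L < M)
    (hf : ∀ᶠ r in atTop, HasDerivAt f (f' r) r) (hg : ∀ᶠ r in atTop, HasDerivAt g (g' r) r)
    (hle : ∀ᶠ r in atTop, f' r ≤ L * g' r) (hg_top : Tendsto g atTop atTop) :
    ∀ᶠ r in atTop, f r / g r ≤ M := by
  obtain ⟨a, ha⟩ := eventually_atTop.1 (hf.and (hg.and hle))
  have hmono : MonotoneOn (fun r => L * g r - f r) (Ioi a) :=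
    monotoneOn_Ioi_of_hasDerivAt_nonneg
      (fun r hr => ((ha r hr.le).2.1.const_mul L).sub (ha r hr.le).1)
      (fun r hr => sub_nonneg.2 (ha r hr.le).2.2)
  filter_upwards [eventually_ge_atTop (a + 1), hg_top.eventually_gt_atTop 0,
    (hg_top.const_mul_atTop (sub_pos.2 hLM)).eventually_ge_atTop
      (f (a + 1) - L * g (a + 1))] with r hr hg0 hg1
  have := hmono (show a < a + 1 by linarith) (show a < r by linarith) hr
  rw [div_le_iff₀ hg0]
  simp only at this
  linarith

/-- L'Hôpital's rule for `∞/∞`, where only the denominator is assumed to diverge. -/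
theorem tendsto_div_of_deriv_div_tendsto {f g f' g' : ℝ → ℝ} {L : ℝ}
    (hf : ∀ᶠ r in atTop, HasDerivAt f (f' r) r) (hg : ∀ᶠ r in atTop, HasDerivAt g (g' r) r)
    (hg' : ∀ᶠ r in atTop, 0 < g' r) (hlim : Tendsto (fun r => f' r / g' r) atTop (𝓝 L))
    (hg_top : Tendsto g atTop atTop) : Tendsto (fun r => f r / g r) atTop (𝓝 L) := by
  refine tendsto_order.2 ⟨fun M hM => ?_, fun M hM => ?_⟩
  · obtain ⟨M₁, hM₁, hM₁L⟩ := exists_between hM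
    obtain ⟨M₂, hM₂, hM₂L⟩ := exists_between hM₁L
    have := eventually_div_le_of_deriv_le (f := fun r => -f r) (neg_lt_neg hM₂)
      (hf.mono fun r hr => hr.neg) hg ?_ hg_top
    · filter_upwards [this] with r hr
      rw [neg_div] at hr
      linarith
    · filter_upwards [hg', hlim.eventually_const_lt hM₂L] with r hr h1
      rw [lt_div_iff₀ hr] at h1
      linarith
  · obtain ⟨M₁, hM₁, hM₁L⟩ := exists_between hM
    obtain ⟨M₂, hM₂, hM₂L⟩ := exists_between hM₁
    have := eventually_div_le_of_deriv_le hM₂L hf hg ?_ hg_top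
    · filter_upwards [this] with r hr
      linarith
    · filter_upwards [hg', hlim.eventually_lt_const hM₂] with r hr h1
      rw [div_lt_iff₀ hr] at h1
      linarith

end HalfLine

namespace ModelManifold

/-! ### Model functions, volume and the volume-surface ratio -/

/-- The volume of the geodesic ball of radius `r`, up to the area of the unit sphere. -/
def ballVol (n : ℕ) (ψ : ℝ → ℝ) (r : ℝ) : ℝ := ∫ s in (0 : ℝ)..r, ψ s ^ (n - 1)

theorem Theta_eq (n : ℕ) (ψ : ℝ → ℝ) (r : ℝ) : Theta n ψ r = ballVol n ψ r / ψ r ^ (n - 1) := rfl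

namespace IsCartanHadamardModel

variable {n : ℕ} {ψ : ℝ → ℝ} (hψ : IsCartanHadamardModel ψ)
include hψ

theorem contDiffAt {r : ℝ} (hr : 0 < r) : ContDiffAt ℝ 2 ψ r :=
  hψ.contDiffOn.contDiffAt (Ici_mem_nhds hr)

theorem continuousOn : ContinuousOn ψ (Ici 0) := hψ.contDiffOn.continuousOn

theorem hasDerivAt {r : ℝ} (hr : 0 < r) : HasDerivAt ψ (deriv ψ r) r :=
  ((hψ.contDiffAt hr).differentiableAt (by norm_num)).hasDerivAt

theorem hasDerivAt_deriv {r : ℝ} (hr : 0 < r) : HasDerivAt (deriv ψ) (deriv (deriv ψ) r) r := by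
  have h2 : ContDiffOn ℝ 2 ψ (Ioi 0) := hψ.contDiffOn.mono Ioi_subset_Ici_self
  have h1 : ContDiffOn ℝ 1 (deriv ψ) (Ioi 0) := h2.deriv_of_isOpen isOpen_Ioi (by norm_num)
  exact ((h1.contDiffAt (Ioi_mem_nhds hr)).differentiableAt (by norm_num)).hasDerivAt

theorem self_le {r : ℝ} (hr : 0 ≤ r) : r ≤ ψ r := by
  rcases hr.eq_or_lt with rfl | hr
  · exact hψ.map_zero.ge
  have := hψ.convexOn.le_slope_of_hasDerivWithinAt (mem_Ici.2 le_rfl) (mem_Ici.2 hr.le) hr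
    hψ.hasDerivWithinAt_zero
  rw [slope_def_field, hψ.map_zero, sub_zero, sub_zero, le_div_iff₀ hr] at this
  linarith

theorem pos {r : ℝ} (hr : 0 < r) : 0 < ψ r := hr.trans_le (hψ.self_le hr.le)

theorem le_mul_deriv {r : ℝ} (hr : 0 < r) : ψ r ≤ r * deriv ψ r := by
  have := hψ.convexOn.slope_le_of_hasDerivAt (mem_Ici.2 le_rfl) (mem_Ici.2 hr.le) hr
    (hψ.hasDerivAt hr)
  rw [slope_def_field, hψ.map_zero, sub_zero, sub_zero, div_le_iff₀ hr] at this
  linarith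

theorem one_le_deriv {r : ℝ} (hr : 0 < r) : 1 ≤ deriv ψ r := by
  have h1 := hψ.le_mul_deriv hr
  have h2 := hψ.self_le hr.le
  by_contra! h
  nlinarith

theorem deriv_pos {r : ℝ} (hr : 0 < r) : 0 < deriv ψ r := one_pos.trans_le (hψ.one_le_deriv hr)

theorem deriv_monotoneOn : MonotoneOn (deriv ψ) (Ioi 0) :=
  (hψ.convexOn.subset Ioi_subset_Ici_self (convex_Ioi 0)).monotoneOn_deriv
    fun _ hr => (hψ.hasDerivAt hr).differentiableAt

theorem monotoneOn : MonotoneOn ψ (Ici 0) :=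
  monotoneOn_Ici_of_hasDerivAt_nonneg hψ.continuousOn (fun _ hr => hψ.hasDerivAt hr)
    fun _ hr => (hψ.deriv_pos hr).le

theorem div_le_div_of_le {r R : ℝ} (hr : 0 < r) (hrR : r ≤ R) : ψ r / r ≤ ψ R / R := by
  rcases hrR.eq_or_lt with rfl | hlt
  · rfl
  have := hψ.convexOn.secant_mono (a := 0) (x := r) (y := R) (mem_Ici.2 le_rfl) (mem_Ici.2 hr.le)
    (mem_Ici.2 (hr.le.trans hrR)) hr.ne' (hr.trans hlt).ne' hrR
  simpa [hψ.map_zero] using this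

theorem continuousOn_pow (k : ℕ) : ContinuousOn (fun s => ψ s ^ k) (Ici 0) :=
  hψ.continuousOn.pow k

theorem area_pos (k : ℕ) {r : ℝ} (hr : 0 < r) : 0 < ψ r ^ k := pow_pos (hψ.pos hr) k

theorem nonneg {r : ℝ} (hr : 0 ≤ r) : 0 ≤ ψ r := hr.trans (hψ.self_le hr)

theorem hasDerivAt_ballVol {r : ℝ} (hr : 0 < r) :
    HasDerivAt (ballVol n ψ) (ψ r ^ (n - 1)) r :=
  (hψ.continuousOn_pow (n - 1)).hasDerivAt_primitive_Ici hr

theorem continuousOn_ballVol : ContinuousOn (ballVol n ψ) (Ici 0) :=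
  (hψ.continuousOn_pow (n - 1)).continuousOn_primitive_Ici

theorem ballVol_pos {r : ℝ} (hr : 0 < r) : 0 < ballVol n ψ r :=
  intervalIntegral.intervalIntegral_pos_of_pos_on
    ((hψ.continuousOn_pow (n - 1)).intervalIntegrable_of_Ici le_rfl hr.le)
    (fun _ hs => hψ.area_pos _ hs.1) hr

theorem ballVol_le {r : ℝ} (hr : 0 ≤ r) : ballVol n ψ r ≤ r * ψ r ^ (n - 1) := by
  have : ballVol n ψ r ≤ ∫ _ in (0 : ℝ)..r, ψ r ^ (n - 1) :=
    intervalIntegral.integral_mono_on hr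
      ((hψ.continuousOn_pow (n - 1)).intervalIntegrable_of_Ici le_rfl hr) (by simp)
      fun s hs => pow_le_pow_left₀ (hψ.nonneg hs.1) (hψ.monotoneOn hs.1 hr hs.2) _
  simpa using this

theorem Theta_pos {r : ℝ} (hr : 0 < r) : 0 < Theta n ψ r :=
  div_pos (hψ.ballVol_pos hr) (hψ.area_pos _ hr)

theorem Theta_le {r : ℝ} (hr : 0 < r) : Theta n ψ r ≤ r :=
  (div_le_iff₀ (hψ.area_pos _ hr)).2 (hψ.ballVol_le hr.le)

theorem Theta_nonneg {r : ℝ} (hr : 0 ≤ r) : 0 ≤ Theta n ψ r := by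
  rcases hr.eq_or_lt with rfl | hr
  · simp [Theta]
  · exact (hψ.Theta_pos hr).le

theorem tendsto_ballVol : Tendsto (ballVol n ψ) atTop atTop := by
  have hmono : MonotoneOn (fun r => ballVol n ψ r - r) (Ioi 1) :=
    monotoneOn_Ioi_of_hasDerivAt_nonneg
      (fun r hr => (hψ.hasDerivAt_ballVol (one_pos.trans hr)).sub (hasDerivAt_id r))
      (fun r hr => sub_nonneg.2 (one_le_pow₀ (hr.le.trans (hψ.self_le (one_pos.trans hr).le))))
  refine tendsto_atTop_mono' _ ?_ (tendsto_atTop_add_const_right _ (ballVol n ψ 2 - 2) tendsto_id)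
  filter_upwards [eventually_ge_atTop 2] with r hr
  have := hmono (show (1 : ℝ) < 2 by norm_num) (show (1 : ℝ) < r by linarith) hr
  simp only [id] at this ⊢
  linarith

/-- Since `ψ'` is nondecreasing, `(ψ^n)' = n ψ^(n-1) ψ'` is at most `n ψ'(r) ψ^(n-1)` on `[0, r]`.
-/
theorem pow_le_mul_ballVol (hn : n ≠ 0) {r : ℝ} (hr : 0 < r) :
    ψ r ^ n ≤ n * deriv ψ r * ballVol n ψ r := by
  have key : MonotoneOn (fun s => n * deriv ψ r * ballVol n ψ s - ψ s ^ n) (Icc 0 r) := by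
    refine monotoneOn_of_hasDerivWithinAt_nonneg (convex_Icc 0 r)
      (f' := fun s => n * deriv ψ r * ψ s ^ (n - 1) - n * ψ s ^ (n - 1) * deriv ψ s) ?_ ?_ ?_
    · exact (continuousOn_const.mul (hψ.continuousOn_ballVol.mono Icc_subset_Ici_self)).sub
        ((hψ.continuousOn_pow n).mono Icc_subset_Ici_self)
    · intro s hs
      rw [interior_Icc] at hs
      exact (((hψ.hasDerivAt_ballVol hs.1).const_mul _).sub
        ((hψ.hasDerivAt hs.1).pow n)).hasDerivWithinAt
    · intro s hs
      rw [interior_Icc] at hs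
      have h1 := hψ.deriv_monotoneOn hs.1 hr hs.2.le
      have h2 := (hψ.area_pos (n - 1) hs.1).le
      have : 0 ≤ (n : ℝ) * ψ s ^ (n - 1) := by positivity
      nlinarith
  have := key ⟨le_rfl, hr.le⟩ ⟨hr.le, le_rfl⟩ hr.le
  simp only [hψ.map_zero, zero_pow hn, sub_zero] at this
  have h0 : ballVol n ψ 0 = 0 := by simp [ballVol]
  rw [h0] at this
  linarith

theorem hasDerivAt_area (hn : n ≠ 0) {r : ℝ} (hr : 0 < r) :
    HasDerivAt (fun s => ψ s ^ (n - 1)) (((n : ℝ) - 1) * ψ r ^ (n - 1) * (deriv ψ r / ψ r)) r := by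
  have h := (hψ.hasDerivAt hr).pow (n - 1)
  refine h.congr_deriv ?_
  have hp := (hψ.pos hr).ne'
  obtain ⟨k, rfl⟩ := Nat.exists_eq_succ_of_ne_zero hn
  rcases k with _ | k
  · simp
  · simp only [Nat.succ_eq_add_one, Nat.add_sub_cancel]
    push_cast
    field_simp
    ring

/-- The derivative of `Θ`. -/
theorem hasDerivAt_Theta (hn : n ≠ 0) {r : ℝ} (hr : 0 < r) :
    HasDerivAt (Theta n ψ) (1 - ((n : ℝ) - 1) * (Theta n ψ r * (deriv ψ r / ψ r))) r := by
  have hS := (hψ.area_pos (n - 1) hr).ne'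
  refine ((hψ.hasDerivAt_ballVol hr).div (hψ.hasDerivAt_area hn hr) hS).congr_deriv ?_
  rw [Theta_eq]
  have hp := (hψ.pos hr).ne'
  field_simp

/-- This is how convexity enters the Pohozaev inequality; equality holds for the Euclidean model
`ψ(r) = r`. -/
theorem inv_le_Theta_mul (hn : n ≠ 0) {r : ℝ} (hr : 0 < r) :
    1 / (n : ℝ) ≤ Theta n ψ r * (deriv ψ r / ψ r) := by
  have hp := hψ.pos hr
  have hn' : (0 : ℝ) < n := by positivity
  have h := hψ.pow_le_mul_ballVol hn hr
  rw [Theta_eq, div_mul_div_comm, ← pow_succ, Nat.sub_add_cancel (Nat.one_le_iff_ne_zero.2 hn),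
    div_le_div_iff₀ hn' (pow_pos hp n)]
  linarith

theorem continuousOn_Theta : ContinuousOn (Theta n ψ) (Ici 0) := by
  intro r hr
  rcases (mem_Ici.1 hr).eq_or_lt with rfl | hr
  · have h0 : Theta n ψ 0 = 0 := by simp [Theta]
    refine tendsto_of_tendsto_of_tendsto_of_le_of_le' (g := fun _ => 0) (h := fun r : ℝ => r)
      (by rw [h0]; exact tendsto_const_nhds)
      (by rw [h0]; exact tendsto_nhdsWithin_of_tendsto_nhds tendsto_id) ?_ ?_
    · filter_upwards [self_mem_nhdsWithin] with r hr
      exact hψ.Theta_nonneg hr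
    · filter_upwards [self_mem_nhdsWithin] with r hr
      rcases (mem_Ici.1 hr).eq_or_lt with rfl | hr
      · exact h0.le
      · exact hψ.Theta_le hr
  · exact ((hψ.continuousOn_ballVol.continuousAt (Ici_mem_nhds hr)).div
      ((hψ.continuousOn_pow _).continuousAt (Ici_mem_nhds hr))
      (hψ.area_pos _ hr).ne').continuousWithinAt

theorem continuousOn_Theta_rpow {a : ℝ} (ha : 0 ≤ a) :
    ContinuousOn (fun r => Theta n ψ r ^ a) (Ici 0) :=
  hψ.continuousOn_Theta.rpow_const fun _ _ => Or.inr ha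

/-- L'Hôpital's rule for `r^γ S / V`: the quotient of derivatives is `γ r^(γ-1) + (n-1) r^γ ψ'/ψ`,
whose first term vanishes at infinity because `γ < 1`. -/
theorem tendsto_mul_Theta_of_stretched (hn : 2 ≤ n) (h : StretchedExponentialGrowth ψ) :
    Tendsto (fun r => Theta n ψ r * (deriv ψ r / ψ r)) atTop (𝓝 (1 / ((n : ℝ) - 1))) := by
  obtain ⟨γ, hγ0, hγ1, ℓ, hℓ, hlim⟩ := h
  have hn0 : n ≠ 0 := by omega
  have hn1 : (0 : ℝ) < (n : ℝ) - 1 := by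
    have : (2 : ℝ) ≤ n := by exact_mod_cast hn
    linarith
  have key : Tendsto (fun r => (r ^ γ * ψ r ^ (n - 1)) / ballVol n ψ r) atTop
      (𝓝 (0 + ((n : ℝ) - 1) * ℓ)) := by
    refine tendsto_div_of_deriv_div_tendsto (g' := fun r => ψ r ^ (n - 1))
      (f' := fun r => γ * r ^ (γ - 1) * ψ r ^ (n - 1)
        + r ^ γ * (((n : ℝ) - 1) * ψ r ^ (n - 1) * (deriv ψ r / ψ r))) ?_ ?_ ?_ ?_
      hψ.tendsto_ballVol
    · filter_upwards [eventually_gt_atTop 0] with r hr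
      exact (Real.hasDerivAt_rpow_const (Or.inl hr.ne')).mul (hψ.hasDerivAt_area hn0 hr)
    · filter_upwards [eventually_gt_atTop 0] with r hr using hψ.hasDerivAt_ballVol hr
    · filter_upwards [eventually_gt_atTop 0] with r hr using hψ.area_pos _ hr
    · have h1 : Tendsto (fun r : ℝ => γ * r ^ (γ - 1)) atTop (𝓝 0) := by
        have := (tendsto_rpow_neg_atTop (y := 1 - γ) (by linarith)).const_mul γ
        rw [mul_zero, neg_sub] at this
        exact this
      refine (h1.add (hlim.const_mul ((n : ℝ) - 1))).congr' ?_
      filter_upwards [eventually_gt_atTop 0] with r hr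
      have := (hψ.area_pos (n - 1) hr).ne'
      field_simp
  rw [zero_add] at key
  refine ((hlim.div key (by positivity)).congr' ?_).trans_eq ?_
  · filter_upwards [eventually_gt_atTop 0] with r hr
    have h1 := (hψ.area_pos (n - 1) hr).ne'
    have h2 := (hψ.ballVol_pos (n := n) hr).ne'
    have h3 := (Real.rpow_pos_of_pos hr γ).ne'
    rw [Theta_eq, Pi.div_apply]
    field_simp
  · congr 1
    field_simp

/-- With `a = ψ'/ψ`, l'Hôpital's rule for `(S/a)/V` has derivative quotient `(n-1) - a'/a²`, and
`a'/a²` is precisely the expression assumed to vanish at infinity. -/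
theorem tendsto_mul_Theta_of_super (hn : 2 ≤ n) (h : SuperExponentialGrowth ψ) :
    Tendsto (fun r => Theta n ψ r * (deriv ψ r / ψ r)) atTop (𝓝 (1 / ((n : ℝ) - 1))) := by
  obtain ⟨-, hlim⟩ := h
  have hn0 : n ≠ 0 := by omega
  have hn1 : (0 : ℝ) < (n : ℝ) - 1 := by
    have : (2 : ℝ) ≤ n := by exact_mod_cast hn
    linarith
  set a : ℝ → ℝ := fun r => deriv ψ r / ψ r with ha
  have ha0 : ∀ r, 0 < r → 0 < a r := fun r hr => div_pos (hψ.deriv_pos hr) (hψ.pos hr)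
  have hader : ∀ r, 0 < r → HasDerivAt a (deriv a r) r := fun r hr =>
    ((hψ.hasDerivAt_deriv hr).div (hψ.hasDerivAt hr) (hψ.pos hr).ne').differentiableAt.hasDerivAt
  have key : Tendsto (fun r => (ψ r ^ (n - 1) / a r) / ballVol n ψ r) atTop
      (𝓝 (((n : ℝ) - 1) - 0)) := by
    refine tendsto_div_of_deriv_div_tendsto (g' := fun r => ψ r ^ (n - 1))
      (f' := fun r => ((((n : ℝ) - 1) * ψ r ^ (n - 1) * (deriv ψ r / ψ r)) * a r
        - ψ r ^ (n - 1) * deriv a r) / a r ^ 2) ?_ ?_ ?_ ?_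
      hψ.tendsto_ballVol
    · filter_upwards [eventually_gt_atTop 0] with r hr
      exact (hψ.hasDerivAt_area hn0 hr).div (hader r hr) (ha0 r hr).ne'
    · filter_upwards [eventually_gt_atTop 0] with r hr using hψ.hasDerivAt_ballVol hr
    · filter_upwards [eventually_gt_atTop 0] with r hr using hψ.area_pos _ hr
    · refine (hlim.const_sub ((n : ℝ) - 1)).congr' ?_
      filter_upwards [eventually_gt_atTop 0] with r hr
      have h1 := (hψ.area_pos (n - 1) hr).ne'
      have h2 := (ha0 r hr).ne'
      have h3 : ψ r / deriv ψ r = 1 / a r := by simp [ha]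
      have h4 : deriv (fun s => Real.log (deriv ψ s / ψ s)) r = deriv a r / a r :=
        ((hader r hr).log h2).deriv
      rw [h3, h4, show deriv ψ r / ψ r = a r from rfl]
      field_simp
  rw [sub_zero] at key
  refine (key.inv₀ hn1.ne').congr' ?_ |>.trans_eq (by rw [one_div])
  filter_upwards [eventually_gt_atTop 0] with r hr
  have h1 := (hψ.area_pos (n - 1) hr).ne'
  have h2 := (hψ.ballVol_pos (n := n) hr).ne'
  have h3 := (ha0 r hr).ne'
  rw [Theta_eq, show deriv ψ r / ψ r = a r from rfl]
  field_simp

/-- Under either growth condition `Θ'` vanishes at infinity. -/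
theorem tendsto_deriv_Theta (hn : 2 ≤ n)
    (h : StretchedExponentialGrowth ψ ∨ SuperExponentialGrowth ψ) :
    Tendsto (fun r => 1 - ((n : ℝ) - 1) * (Theta n ψ r * (deriv ψ r / ψ r))) atTop (𝓝 0) := by
  have hn1 : (n : ℝ) - 1 ≠ 0 := by
    have : (2 : ℝ) ≤ n := by exact_mod_cast hn
    linarith
  have h1 := h.elim (hψ.tendsto_mul_Theta_of_stretched hn) (hψ.tendsto_mul_Theta_of_super hn)
  have h2 := (h1.const_mul ((n : ℝ) - 1)).const_sub 1
  rwa [mul_one_div_cancel hn1, sub_self] at h2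

end IsCartanHadamardModel

end ModelManifold

namespace ModelManifold

/-! ### The radial equation -/

/-- The integral of `f ^ q` over the geodesic ball of radius `r`, up to the area of the unit
sphere. -/
def ballMass (n : ℕ) (q : ℝ) (ψ f : ℝ → ℝ) (r : ℝ) : ℝ :=
  ∫ s in (0 : ℝ)..r, ψ s ^ (n - 1) * f s ^ q

/-- Positive classical solutions of the radial equation
`(ψ^(n-1) |f'|^(p-1))' = ψ^(n-1) f^q`, in integrated form. -/
structure IsRadialODESolution (n : ℕ) (p q : ℝ) (ψ f : ℝ → ℝ) : Prop where
  continuousOn : ContinuousOn f (Ici 0)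
  pos : ∀ r, 0 ≤ r → 0 < f r
  hasDerivAt : ∀ r, 0 < r →
    HasDerivAt f (-(ballMass n q ψ f r / ψ r ^ (n - 1)) ^ (1 / (p - 1))) r

/-- The integral `∫_0^r Θ^(1/(p-1))`. -/
def ThetaInt (n : ℕ) (ψ : ℝ → ℝ) (p : ℝ) (r : ℝ) : ℝ :=
  ∫ s in (0 : ℝ)..r, Theta n ψ s ^ (1 / (p - 1))

section ThetaInt

variable {n : ℕ} {p : ℝ} {ψ : ℝ → ℝ}

theorem ThetaInt_zero : ThetaInt n ψ p 0 = 0 := by simp [ThetaInt]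

theorem IsCartanHadamardModel.hasDerivAt_ThetaInt (hψ : IsCartanHadamardModel ψ) (hp : 1 < p)
    {r : ℝ} (hr : 0 < r) : HasDerivAt (ThetaInt n ψ p) (Theta n ψ r ^ (1 / (p - 1))) r :=
  (hψ.continuousOn_Theta_rpow
    (one_div_nonneg.2 (sub_nonneg.2 hp.le))).hasDerivAt_primitive_Ici hr

theorem IsCartanHadamardModel.continuousOn_ThetaInt (hψ : IsCartanHadamardModel ψ) (hp : 1 < p) :
    ContinuousOn (ThetaInt n ψ p) (Ici 0) :=
  (hψ.continuousOn_Theta_rpow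
    (one_div_nonneg.2 (sub_nonneg.2 hp.le))).continuousOn_primitive_Ici

theorem IsCartanHadamardModel.ThetaInt_pos (hψ : IsCartanHadamardModel ψ) (hp : 1 < p)
    {r : ℝ} (hr : 0 < r) : 0 < ThetaInt n ψ p r :=
  intervalIntegral.intervalIntegral_pos_of_pos_on
    ((hψ.continuousOn_Theta_rpow
      (one_div_nonneg.2 (sub_nonneg.2 hp.le))).intervalIntegrable_of_Ici le_rfl hr.le)
    (fun _ hs => Real.rpow_pos_of_pos (hψ.Theta_pos hs.1) _) hr

theorem IsCartanHadamardModel.ThetaInt_monotoneOn (hψ : IsCartanHadamardModel ψ) (hp : 1 < p) :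
    MonotoneOn (ThetaInt n ψ p) (Ici 0) :=
  monotoneOn_Ici_of_hasDerivAt_nonneg (hψ.continuousOn_ThetaInt hp)
    (fun _ hr => hψ.hasDerivAt_ThetaInt hp hr)
    fun _ hr => (Real.rpow_pos_of_pos (hψ.Theta_pos hr) _).le

theorem IsCartanHadamardModel.tendsto_ThetaInt (hψ : IsCartanHadamardModel ψ) (hp : 1 < p)
    (h : PStochasticallyComplete n ψ p) : Tendsto (ThetaInt n ψ p) atTop atTop := by
  have ha : 0 ≤ 1 / (p - 1) := one_div_nonneg.2 (sub_nonneg.2 hp.le)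
  by_contra hcon
  refine h ?_
  have hbdd : ∃ C, ∀ r, 0 ≤ r → ThetaInt n ψ p r ≤ C := by
    by_contra! hub
    refine hcon (tendsto_atTop.2 fun b => ?_)
    obtain ⟨r, hr0, hr⟩ := hub b
    filter_upwards [eventually_ge_atTop r] with s hs
    exact hr.le.trans (hψ.ThetaInt_monotoneOn hp hr0 (hr0.trans hs) hs)
  obtain ⟨C, hC⟩ := hbdd
  refine integrableOn_Ioi_of_intervalIntegral_norm_bounded (l := atTop) (b := fun r : ℝ => r) C 0
    (fun r => ?_) tendsto_id ?_
  · rcases le_total r 0 with hr | hr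
    · simp [Ioc_eq_empty (not_lt.2 hr)]
    · exact (((hψ.continuousOn_Theta_rpow ha).mono Icc_subset_Ici_self).integrableOn_Icc).mono_set
        Ioc_subset_Icc_self
  · filter_upwards [eventually_ge_atTop 0] with r hr
    refine le_trans (le_of_eq ?_) (hC r hr)
    refine intervalIntegral.integral_congr fun s hs => ?_
    rw [uIcc_of_le hr] at hs
    exact Real.norm_of_nonneg (Real.rpow_nonneg (hψ.Theta_nonneg hs.1) _)

end ThetaInt

namespace IsRadialODESolution

variable {n : ℕ} {p q : ℝ} {ψ f : ℝ → ℝ} (hf : IsRadialODESolution n p q ψ f)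
  (hψ : IsCartanHadamardModel ψ)

include hf

theorem continuousOn_rpow (a : ℝ) : ContinuousOn (fun r => f r ^ a) (Ici 0) :=
  hf.continuousOn.rpow_const fun r hr => Or.inl (hf.pos r hr).ne'

include hψ

theorem continuousOn_integrand : ContinuousOn (fun s => ψ s ^ (n - 1) * f s ^ q) (Ici 0) :=
  (hψ.continuousOn_pow _).mul (hf.continuousOn_rpow q)

theorem hasDerivAt_ballMass {r : ℝ} (hr : 0 < r) :
    HasDerivAt (ballMass n q ψ f) (ψ r ^ (n - 1) * f r ^ q) r :=
  (hf.continuousOn_integrand hψ).hasDerivAt_primitive_Ici hr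

theorem continuousOn_ballMass : ContinuousOn (ballMass n q ψ f) (Ici 0) :=
  (hf.continuousOn_integrand hψ).continuousOn_primitive_Ici

theorem ballMass_pos {r : ℝ} (hr : 0 < r) : 0 < ballMass n q ψ f r :=
  intervalIntegral.intervalIntegral_pos_of_pos_on
    ((hf.continuousOn_integrand hψ).intervalIntegrable_of_Ici le_rfl hr.le)
    (fun _ hs => mul_pos (hψ.area_pos _ hs.1) (Real.rpow_pos_of_pos (hf.pos _ hs.1.le) _)) hr

theorem antitoneOn : AntitoneOn f (Ici 0) :=
  antitoneOn_Ici_of_hasDerivAt_nonpos hf.continuousOn hf.hasDerivAt fun _ hr =>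
    neg_nonpos.2 (Real.rpow_nonneg (div_pos (hf.ballMass_pos hψ hr) (hψ.area_pos _ hr)).le _)

theorem ballVol_mul_le_ballMass (hq : 0 ≤ q) {r : ℝ} (hr : 0 < r) :
    ballVol n ψ r * f r ^ q ≤ ballMass n q ψ f r := by
  rw [ballVol, ballMass, ← intervalIntegral.integral_mul_const]
  refine intervalIntegral.integral_mono_on hr.le
    (((hψ.continuousOn_pow _).mul continuousOn_const).intervalIntegrable_of_Ici le_rfl hr.le)
    ((hf.continuousOn_integrand hψ).intervalIntegrable_of_Ici le_rfl hr.le) fun s hs => ?_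
  exact mul_le_mul_of_nonneg_left (Real.rpow_le_rpow (hf.pos _ hr.le).le
    (hf.antitoneOn hψ hs.1 hr.le hs.2) hq) (pow_nonneg (hψ.nonneg hs.1) _)

theorem ballMass_le (hq : 0 ≤ q) {r : ℝ} (hr : 0 < r) :
    ballMass n q ψ f r ≤ ballVol n ψ r * f 0 ^ q := by
  rw [ballVol, ballMass, ← intervalIntegral.integral_mul_const]
  refine intervalIntegral.integral_mono_on hr.le
    ((hf.continuousOn_integrand hψ).intervalIntegrable_of_Ici le_rfl hr.le)
    (((hψ.continuousOn_pow _).mul continuousOn_const).intervalIntegrable_of_Ici le_rfl hr.le)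
    fun s hs => ?_
  exact mul_le_mul_of_nonneg_left (Real.rpow_le_rpow (hf.pos _ hs.1).le
    (hf.antitoneOn hψ self_mem_Ici hs.1 hs.1) hq) (pow_nonneg (hψ.nonneg hs.1) _)

/-- Separates the slope into the geometric factor `Θ^(1/(p-1))` and a power of the average `m/V` of
`f^q`. -/
theorem rpow_ballMass_div {r : ℝ} (hr : 0 < r) :
    (ballMass n q ψ f r / ψ r ^ (n - 1)) ^ (1 / (p - 1))
      = Theta n ψ r ^ (1 / (p - 1))
        * (ballMass n q ψ f r / ballVol n ψ r) ^ (1 / (p - 1)) := by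
  have hV := hψ.ballVol_pos (n := n) hr
  rw [← Real.mul_rpow (hψ.Theta_nonneg hr.le) (div_pos (hf.ballMass_pos hψ hr) hV).le, Theta_eq]
  congr 1
  field_simp

/-- The derivative of `f ^ (-α)`, `α = (q+1-p)/(p-1)`. -/
theorem hasDerivAt_rpow_neg (hp : 1 < p) {r : ℝ} (hr : 0 < r) :
    HasDerivAt (fun s => f s ^ (-((q + 1 - p) / (p - 1))))
      ((q + 1 - p) / (p - 1) * (ballMass n q ψ f r / (ballVol n ψ r * f r ^ q)) ^ (1 / (p - 1))
        * Theta n ψ r ^ (1 / (p - 1))) r := by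
  have hf0 := hf.pos r hr.le
  refine ((hf.hasDerivAt r hr).rpow_const (Or.inl hf0.ne')).congr_deriv ?_
  have hV := hψ.ballVol_pos (n := n) hr
  have hm := hf.ballMass_pos hψ hr
  have hp1 : p - 1 ≠ 0 := by linarith
  rw [hf.rpow_ballMass_div hψ hr, ← div_div,
    Real.div_rpow (div_pos hm hV).le (Real.rpow_nonneg hf0.le _), ← Real.rpow_mul hf0.le,
    show -((q + 1 - p) / (p - 1)) - 1 = -(q * (1 / (p - 1))) by field_simp; ring,
    Real.rpow_neg hf0.le]
  have := (Real.rpow_pos_of_pos hf0 (q * (1 / (p - 1)))).ne'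
  field_simp

/-- Because `f` decreases, `m ≥ V f^q`, so the derivative of `f^(-α)` is at least `α Θ^(1/(p-1))`.
-/
theorem ThetaInt_le_rpow_neg (hp : 1 < p) (hpq : p < q + 1) {r : ℝ} (hr : 0 ≤ r) :
    (q + 1 - p) / (p - 1) * ThetaInt n ψ p r ≤ f r ^ (-((q + 1 - p) / (p - 1))) := by
  have hα : 0 < (q + 1 - p) / (p - 1) := div_pos (by linarith) (by linarith)
  have hmono := monotoneOn_Ici_of_hasDerivAt_nonneg
    (f := fun r => f r ^ (-((q + 1 - p) / (p - 1))) - (q + 1 - p) / (p - 1) * ThetaInt n ψ p r)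
    ((hf.continuousOn_rpow _).sub (continuousOn_const.mul (hψ.continuousOn_ThetaInt hp)))
    (fun r hr => (hf.hasDerivAt_rpow_neg hψ hp hr).sub
      ((hψ.hasDerivAt_ThetaInt hp hr).const_mul _)) ?_
  · have := hmono self_mem_Ici hr hr
    have h0 := Real.rpow_pos_of_pos (hf.pos 0 le_rfl) (-((q + 1 - p) / (p - 1)))
    simp only [ThetaInt_zero] at this
    linarith
  · intro r hr
    have hV := hψ.ballVol_pos (n := n) hr
    have hden := mul_pos hV (Real.rpow_pos_of_pos (hf.pos r hr.le) q)
    have h1 : 1 ≤ (ballMass n q ψ f r / (ballVol n ψ r * f r ^ q)) ^ (1 / (p - 1)) :=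
      Real.one_le_rpow ((one_le_div hden).2 (hf.ballVol_mul_le_ballMass hψ (by linarith) hr))
        (one_div_nonneg.2 (by linarith))
    have h2 := (Real.rpow_pos_of_pos (hψ.Theta_pos (n := n) hr) (1 / (p - 1))).le
    rw [sub_nonneg, mul_assoc]
    exact mul_le_mul_of_nonneg_left (le_mul_of_one_le_left h2 h1) hα.le

theorem continuousOn_ballMass_div (hq : 0 ≤ q) :
    ContinuousOn (fun r => ballMass n q ψ f r / ψ r ^ (n - 1)) (Ici 0) := by
  intro r hr
  rcases (mem_Ici.1 hr).eq_or_lt with rfl | hr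
  -- At the pole the numerator is zero, so the quotient is zero whatever the denominator; nearby it
  -- is squeezed below `Θ f(0)^q`.
  · have h0 : ballMass n q ψ f 0 / ψ 0 ^ (n - 1) = 0 := by simp [ballMass]
    have hT : Tendsto (fun r => Theta n ψ r * f 0 ^ q) (𝓝[Ici 0] 0) (𝓝 0) := by
      have := (hψ.continuousOn_Theta (n := n) 0 self_mem_Ici).tendsto.mul_const (f 0 ^ q)
      simpa [Theta] using this
    rw [ContinuousWithinAt, h0]
    refine tendsto_of_tendsto_of_tendsto_of_le_of_le' tendsto_const_nhds hT ?_ ?_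
    · filter_upwards [self_mem_nhdsWithin] with r hr
      rcases (mem_Ici.1 hr).eq_or_lt with rfl | hr
      · exact h0.ge
      · exact (div_pos (hf.ballMass_pos hψ hr) (hψ.area_pos _ hr)).le
    · filter_upwards [self_mem_nhdsWithin] with r hr
      rcases (mem_Ici.1 hr).eq_or_lt with rfl | hr
      · rw [h0]
        exact mul_nonneg (hψ.Theta_nonneg le_rfl) (Real.rpow_nonneg (hf.pos 0 le_rfl).le _)
      · rw [Theta_eq, div_mul_eq_mul_div]
        exact div_le_div_of_nonneg_right (hf.ballMass_le hψ hq hr) (hψ.area_pos _ hr).le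
  · exact (((hf.continuousOn_ballMass hψ).continuousAt (Ici_mem_nhds hr)).div
      ((hψ.continuousOn_pow _).continuousAt (Ici_mem_nhds hr))
      (hψ.area_pos _ hr).ne').continuousWithinAt

/-- The Pohozaev inequality. -/
theorem pohozaev (hn : 2 ≤ n) (hp : 1 < p) (hpq : p < q + 1)
    (hcrit : 1 / (n : ℝ) ≤ 1 / p - 1 / (q + 1)) {r : ℝ} (hr : 0 < r) :
    ballVol n ψ r * ((p - 1) / p * ((ballMass n q ψ f r / ψ r ^ (n - 1))
        * (ballMass n q ψ f r / ψ r ^ (n - 1)) ^ (1 / (p - 1))) + f r ^ q * f r / (q + 1))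
      ≤ ballMass n q ψ f r * f r / (q + 1) := by
  have hn0 : n ≠ 0 := by omega
  have hp0 : 0 < p := by linarith
  have hp1 : 0 < p - 1 := by linarith
  have hq1 : 0 < q + 1 := by linarith
  set w : ℝ → ℝ := fun r => ballMass n q ψ f r / ψ r ^ (n - 1) with hw
  have hwpos : ∀ r, 0 < r → 0 < w r := fun r hr =>
    div_pos (hf.ballMass_pos hψ hr) (hψ.area_pos _ hr)
  have hwc : ContinuousOn w (Ici 0) := hf.continuousOn_ballMass_div hψ (by linarith)
  have hpa : 0 ≤ p / (p - 1) := by positivity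
  -- The Pohozaev functional, which vanishes at `r = 0`. In its derivative the terms containing `f`
  -- cancel, leaving `S w^(p/(p-1))` times a bracket depending only on the geometry and the
  -- exponents.
  have hanti := antitoneOn_Ici_of_hasDerivAt_nonpos (a := 0)
    (f := fun r => ballVol n ψ r * ((p - 1) / p * w r ^ (p / (p - 1)) + f r ^ (q + 1) / (q + 1))
      - ballMass n q ψ f r * f r / (q + 1))
    (f' := fun r => ψ r ^ (n - 1) * (w r * w r ^ (1 / (p - 1)))
      * ((p - 1) / p - ((n : ℝ) - 1) * (Theta n ψ r * (deriv ψ r / ψ r)) + 1 / (q + 1)))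
    ?_ ?_ ?_
  · have h := hanti self_mem_Ici hr.le hr.le
    have hV0 : ballVol n ψ 0 = 0 := by simp [ballVol]
    have hm0 : ballMass n q ψ f 0 = 0 := by simp [ballMass]
    simp only [hV0, hm0, zero_mul, zero_div, sub_zero] at h
    rw [Real.rpow_add_one (hf.pos r hr.le).ne',
      show p / (p - 1) = 1 + 1 / (p - 1) by field_simp; ring,
      Real.rpow_add (hwpos r hr), Real.rpow_one] at h
    exact sub_nonpos.1 h
  · exact (hψ.continuousOn_ballVol.mul ((continuousOn_const.mul
      (hwc.rpow_const fun _ _ => Or.inr hpa)).add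
      ((hf.continuousOn_rpow _).div_const _))).sub
      (((hf.continuousOn_ballMass hψ).mul hf.continuousOn).div_const _)
  · intro r hr
    have hS := hψ.area_pos (n - 1) hr
    have hf0 := hf.pos r hr.le
    have hfd : HasDerivAt f (-(w r) ^ (1 / (p - 1))) r := hf.hasDerivAt r hr
    have hmd := hf.hasDerivAt_ballMass hψ hr
    have hwd := (hmd.div (hψ.hasDerivAt_area hn0 hr) hS.ne').rpow_const (p := p / (p - 1))
      (Or.inl (hwpos r hr).ne')
    have hfq := hfd.rpow_const (p := q + 1) (Or.inl hf0.ne')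
    have hE := ((hψ.hasDerivAt_ballVol (n := n) hr).mul
      ((hwd.const_mul ((p - 1) / p)).add (hfq.div_const (q + 1)))).sub
      ((hmd.mul hfd).div_const (q + 1))
    refine hE.congr_deriv ?_
    have e1 : p / (p - 1) - 1 = 1 / (p - 1) := by field_simp; ring
    have e2 : p / (p - 1) = 1 + 1 / (p - 1) := by field_simp; ring
    have ew : (ballMass n q ψ f / fun s => ψ s ^ (n - 1)) r = w r := rfl
    simp only [Pi.add_apply, ew]
    rw [e1, add_sub_cancel_right, Real.rpow_add_one hf0.ne']
    have e3 : w r ^ (p / (p - 1)) = w r * w r ^ (1 / (p - 1)) := by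
      rw [e2, Real.rpow_add (hwpos r hr), Real.rpow_one]
    have em : ballMass n q ψ f r = w r * ψ r ^ (n - 1) := by
      rw [hw]; field_simp
    change ψ r ^ (n - 1) * ((p - 1) / p * (w r) ^ (p / (p - 1)) + f r ^ q * f r / (q + 1)) + _ - _
      = _
    rw [e3, em, Theta_eq]
    set W := w r ^ (1 / (p - 1))
    have hψ0 := (hψ.pos hr).ne'
    field_simp
    ring
  · intro r hr
    -- Since `(n-1) Θ ψ'/ψ ≥ 1 - 1/n`, the bracket is at most `1/n - 1/p + 1/(q+1)`, which `hcrit`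
    -- makes nonpositive.
    have h1 := hψ.inv_le_Theta_mul hn0 hr
    have hn1 : (1 : ℝ) ≤ (n : ℝ) - 1 := by
      have : (2 : ℝ) ≤ n := by exact_mod_cast hn
      linarith
    have h2 := mul_le_mul_of_nonneg_left h1 (by linarith : (0 : ℝ) ≤ (n : ℝ) - 1)
    have h3 : ((n : ℝ) - 1) * (1 / (n : ℝ)) = 1 - 1 / (n : ℝ) := by
      have : (n : ℝ) ≠ 0 := by positivity
      field_simp
    have h4 : (p - 1) / p = 1 - 1 / p := by field_simp
    refine mul_nonpos_of_nonneg_of_nonpos ?_ (by linarith)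
    exact mul_nonneg (hψ.area_pos _ hr).le
      (mul_nonneg (hwpos r hr).le (Real.rpow_nonneg (hwpos r hr).le _))

end IsRadialODESolution

end ModelManifold

/-! ### Growth estimates and asymptotics for the radial equation. -/

namespace ModelManifold

namespace IsRadialODESolution

variable {n : ℕ} {p q : ℝ} {ψ f : ℝ → ℝ} (hf : IsRadialODESolution n p q ψ f)
  (hψ : IsCartanHadamardModel ψ)

include hf hψ

/-- The quantity `f (V/m)^(1/(p-1))` grows at least like a multiple of `∫ Θ^(1/(p-1))`. -/
theorem exists_hasDerivAt_mul_rpow (hn : 2 ≤ n) (hp : 1 < p) (hpq : p < q + 1)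
    (hcrit : 1 / (n : ℝ) ≤ 1 / p - 1 / (q + 1)) {r : ℝ} (hr : 0 < r) :
    ∃ d, HasDerivAt
      (fun r => f r * (ballVol n ψ r / ballMass n q ψ f r) ^ (1 / (p - 1))) d r ∧
      (q + 1 - p) / p * Theta n ψ r ^ (1 / (p - 1)) ≤ d := by
  have hV := hψ.ballVol_pos (n := n) hr
  have hm := hf.ballMass_pos hψ hr
  have hS := hψ.area_pos (n - 1) hr
  have hf0 := hf.pos r hr.le
  have hp1 : 0 < p - 1 := by linarith
  have hp0 : 0 < p := by linarith
  have hq1 : 0 < q + 1 := by linarith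
  have hVm := div_pos hV hm
  refine ⟨_, (hf.hasDerivAt r hr).mul (((hψ.hasDerivAt_ballVol hr).div
    (hf.hasDerivAt_ballMass hψ hr) hm.ne').rpow_const (Or.inl hVm.ne')), ?_⟩
  have hP := hf.pohozaev hψ hn hp hpq hcrit hr
  change _ ≤ -(ballMass n q ψ f r / ψ r ^ (n - 1)) ^ (1 / (p - 1))
      * (ballVol n ψ r / ballMass n q ψ f r) ^ (1 / (p - 1))
      + f r * (_ * (1 / (p - 1)) * (ballVol n ψ r / ballMass n q ψ f r) ^ (1 / (p - 1) - 1))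
  rw [Real.rpow_sub_one hVm.ne']
  have hXW : (ballMass n q ψ f r / ψ r ^ (n - 1)) ^ (1 / (p - 1))
      * (ballVol n ψ r / ballMass n q ψ f r) ^ (1 / (p - 1)) = Theta n ψ r ^ (1 / (p - 1)) := by
    rw [← Real.mul_rpow (div_pos hm hS).le hVm.le, Theta_eq]
    congr 1
    field_simp
  have hX : 0 < (ballVol n ψ r / ballMass n q ψ f r) ^ (1 / (p - 1)) :=
    Real.rpow_pos_of_pos hVm _
  rw [neg_mul, ← hXW]
  set X := (ballVol n ψ r / ballMass n q ψ f r) ^ (1 / (p - 1))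
  set W := (ballMass n q ψ f r / ψ r ^ (n - 1)) ^ (1 / (p - 1))
  set V := ballVol n ψ r
  set m := ballMass n q ψ f r
  set S := ψ r ^ (n - 1)
  -- The right side is the contribution of `(V/m)'` to the derivative. The Pohozaev inequality,
  -- solved for `f (m - V f^q)`, bounds it below by `(q+1)/p` times `Θ^(1/(p-1)) = W X`; the term
  -- from `f'` then subtracts one `W X`.
  have key : (q + 1) / p * (W * X) ≤ X * S * (f r * (m - V * f r ^ q)) / ((p - 1) * (V * m)) := by
    have h1 : V * ((p - 1) / p * (m / S * W)) * (q + 1) ≤ f r * (m - V * f r ^ q) := by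
      have h2 : V * (f r ^ q * f r / (q + 1)) * (q + 1) = V * f r ^ q * f r := by field_simp
      have h3 : m * f r / (q + 1) * (q + 1) = m * f r := by field_simp
      nlinarith [mul_le_mul_of_nonneg_right hP hq1.le]
    have h4 := mul_le_mul_of_nonneg_left h1 (mul_pos hX hS).le
    calc (q + 1) / p * (W * X)
        = X * S * (V * ((p - 1) / p * (m / S * W)) * (q + 1)) / ((p - 1) * (V * m)) := by
          field_simp
      _ ≤ _ := div_le_div_of_nonneg_right h4 (by positivity)
  have e1 : f r * ((S * m - V * (S * f r ^ q)) / m ^ 2 * (1 / (p - 1)) * (X / (V / m)))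
      = X * S * (f r * (m - V * f r ^ q)) / ((p - 1) * (V * m)) := by
    field_simp
  have e2 : (q + 1 - p) / p * (W * X) = (q + 1) / p * (W * X) - W * X := by
    field_simp
  rw [e1, e2]
  linarith

theorem monotoneOn_mul_rpow_sub (hn : 2 ≤ n) (hp : 1 < p) (hpq : p < q + 1)
    (hcrit : 1 / (n : ℝ) ≤ 1 / p - 1 / (q + 1)) :
    MonotoneOn (fun r => f r * (ballVol n ψ r / ballMass n q ψ f r) ^ (1 / (p - 1))
      - (q + 1 - p) / p * ThetaInt n ψ p r) (Ioi 0) := by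
  have h := fun r (hr : 0 < r) => hf.exists_hasDerivAt_mul_rpow hψ hn hp hpq hcrit hr
  choose! d hd hle using h
  exact monotoneOn_Ioi_of_hasDerivAt_nonneg
    (fun r hr => (hd r hr).sub ((hψ.hasDerivAt_ThetaInt hp hr).const_mul _))
    fun r hr => sub_nonneg.2 (hle r hr)

theorem mul_rpow_pos {r : ℝ} (hr : 0 < r) :
    0 < f r * (ballVol n ψ r / ballMass n q ψ f r) ^ (1 / (p - 1)) :=
  mul_pos (hf.pos r hr.le)
    (Real.rpow_pos_of_pos (div_pos (hψ.ballVol_pos hr) (hf.ballMass_pos hψ hr)) _)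

theorem monotoneOn_mul_rpow (hn : 2 ≤ n) (hp : 1 < p) (hpq : p < q + 1)
    (hcrit : 1 / (n : ℝ) ≤ 1 / p - 1 / (q + 1)) :
    MonotoneOn (fun r => f r * (ballVol n ψ r / ballMass n q ψ f r) ^ (1 / (p - 1)))
      (Ioi 0) := by
  intro r hr s hs hrs
  have h1 := hf.monotoneOn_mul_rpow_sub hψ hn hp hpq hcrit hr hs hrs
  have h2 := hψ.ThetaInt_monotoneOn (n := n) hp (mem_Ioi.1 hr).le (mem_Ioi.1 hs).le hrs
  have h3 : 0 ≤ (q + 1 - p) / p := div_nonneg (by linarith) (by linarith)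
  have := mul_le_mul_of_nonneg_left h2 h3
  simp only at h1 ⊢
  linarith

theorem ThetaInt_le_mul_rpow (hn : 2 ≤ n) (hp : 1 < p) (hpq : p < q + 1)
    (hcrit : 1 / (n : ℝ) ≤ 1 / p - 1 / (q + 1)) {r : ℝ} (hr : 0 < r) :
    (q + 1 - p) / p * ThetaInt n ψ p r
      ≤ f r * (ballVol n ψ r / ballMass n q ψ f r) ^ (1 / (p - 1)) := by
  have hlim : Tendsto (fun s => -((q + 1 - p) / p * ThetaInt n ψ p s)) (𝓝[>] 0) (𝓝 0) := by
    have := ((hψ.continuousOn_ThetaInt (n := n) hp 0 self_mem_Ici).mono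
      Ioi_subset_Ici_self).tendsto.const_mul ((q + 1 - p) / p)
    rw [ThetaInt_zero, mul_zero] at this
    simpa using this.neg
  -- Monotonicity is applied from `s` to `r` and `s → 0`; only positivity of the quantity at `s` is
  -- used, not its limit at the pole.
  have := le_of_tendsto hlim (b := f r * (ballVol n ψ r / ballMass n q ψ f r) ^ (1 / (p - 1))
    - (q + 1 - p) / p * ThetaInt n ψ p r) ?_
  · linarith
  · filter_upwards [self_mem_nhdsWithin, mem_nhdsWithin_of_mem_nhds (gt_mem_nhds hr)] with s hs hsr
    have h1 := hf.monotoneOn_mul_rpow_sub hψ hn hp hpq hcrit hs hr hsr.le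
    have h2 := hf.mul_rpow_pos hψ (mem_Ioi.1 hs)
    simp only at h1
    linarith

/-- The logarithmic derivative of `f`. -/
theorem rpow_ballMass_div_eq {r : ℝ} (hr : 0 < r) :
    (ballMass n q ψ f r / ψ r ^ (n - 1)) ^ (1 / (p - 1)) / f r
      = Theta n ψ r ^ (1 / (p - 1))
        / (f r * (ballVol n ψ r / ballMass n q ψ f r) ^ (1 / (p - 1))) := by
  have hV := hψ.ballVol_pos (n := n) hr
  have hm := hf.ballMass_pos hψ hr
  have hf0 := (hf.pos r hr.le).ne'
  rw [hf.rpow_ballMass_div hψ hr, ← inv_div (ballVol n ψ r), Real.inv_rpow (div_pos hV hm).le]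
  have := (Real.rpow_pos_of_pos (div_pos hV hm) (1 / (p - 1))).ne'
  field_simp

/-- Solutions stay away from zero on stochastically incomplete models. -/
theorem exists_pos_le (hn : 2 ≤ n) (hp : 1 < p) (hpq : p < q + 1)
    (hcrit : 1 / (n : ℝ) ≤ 1 / p - 1 / (q + 1)) {C : ℝ} (hC : ∀ r, 1 ≤ r → ThetaInt n ψ p r ≤ C) :
    ∃ c, 0 < c ∧ ∀ r, 1 ≤ r → c ≤ f r := by
  set Z : ℝ → ℝ := fun r => f r * (ballVol n ψ r / ballMass n q ψ f r) ^ (1 / (p - 1)) with hZ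
  have hZ1 : 0 < Z 1 := hf.mul_rpow_pos hψ one_pos
  -- On `[1, ∞)` one has `|f'|/f = Θ^(1/(p-1))/Z ≤ Θ^(1/(p-1))/Z(1)`, so `log f` loses at most
  -- `C/Z(1)` in total.
  have hmono := monotoneOn_Ici_of_hasDerivAt_nonneg (a := 1)
    (f := fun r => Real.log (f r) + 1 / Z 1 * ThetaInt n ψ p r) ?_
    (fun r hr => ((hf.hasDerivAt r (one_pos.trans hr)).log (hf.pos r (one_pos.trans hr).le).ne').add
      ((hψ.hasDerivAt_ThetaInt hp (one_pos.trans hr)).const_mul (1 / Z 1))) ?_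
  · refine ⟨Real.exp (Real.log (f 1) + 1 / Z 1 * ThetaInt n ψ p 1 - 1 / Z 1 * C),
      Real.exp_pos _, fun r hr => ?_⟩
    have h1 := hmono self_mem_Ici hr hr
    have h2 := mul_le_mul_of_nonneg_left (hC r hr) (one_div_pos.2 hZ1).le
    rw [← Real.le_log_iff_exp_le (hf.pos r (zero_le_one.trans hr))]
    simp only at h1
    linarith
  · have hsub : Ici (1 : ℝ) ⊆ Ici 0 := Ici_subset_Ici.2 zero_le_one
    exact ((hf.continuousOn.mono hsub).log fun r hr => (hf.pos r (hsub hr)).ne').add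
      (continuousOn_const.mul ((hψ.continuousOn_ThetaInt hp).mono hsub))
  · intro r hr
    have hr0 := one_pos.trans hr
    have h1 : Z 1 ≤ Z r := hf.monotoneOn_mul_rpow hψ hn hp hpq hcrit
      (mem_Ioi.2 one_pos) (mem_Ioi.2 hr0) hr.le
    have h2 := Real.rpow_pos_of_pos (hψ.Theta_pos (n := n) hr0) (1 / (p - 1))
    rw [neg_div, hf.rpow_ballMass_div_eq hψ hr0]
    have : Theta n ψ r ^ (1 / (p - 1)) / Z r ≤ 1 / Z 1 * Theta n ψ r ^ (1 / (p - 1)) := by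
      rw [one_div_mul_eq_div]
      exact div_le_div_of_nonneg_left h2.le hZ1 h1
    linarith

theorem exists_tendsto_of_le {c : ℝ} (hc : ∀ r, 1 ≤ r → c ≤ f r) :
    ∃ l, c ≤ l ∧ Tendsto f atTop (𝓝 l) := by
  have hanti : Antitone fun r => f (max 1 r) := fun r s hrs =>
    hf.antitoneOn hψ (mem_Ici.2 (zero_le_one.trans (le_max_left _ _)))
      (mem_Ici.2 (zero_le_one.trans (le_max_left _ _))) (max_le_max_left _ hrs)
  have hlim := tendsto_atTop_ciInf hanti ⟨c, by rintro _ ⟨r, rfl⟩; exact hc _ (le_max_left _ _)⟩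
  refine ⟨_, le_ciInf fun r => hc _ (le_max_left _ _), hlim.congr' ?_⟩
  filter_upwards [eventually_ge_atTop 1] with r hr
  rw [max_eq_right hr]

/-- Asymptotics on stochastically incomplete models. -/
theorem asymptotics_of_incomplete (hn : 2 ≤ n) (hp : 1 < p) (hpq : p < q + 1)
    (hcrit : 1 / (n : ℝ) ≤ 1 / p - 1 / (q + 1)) (hinc : PStochasticallyIncomplete n ψ p) :
    ∃ l : ℝ, 0 < l ∧ Tendsto f atTop (𝓝 l) ∧
      Tendsto (fun r : ℝ => (∫ s in Ioi r, Theta n ψ s ^ (1 / (p - 1)))⁻¹ * (f r - l))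
        atTop (𝓝 (l ^ (q / (p - 1)))) ∧
      l ≤ ((p - 1) / (q + 1 - p)) ^ ((p - 1) / (q + 1 - p))
        * (∫ s in Ioi (0 : ℝ), Theta n ψ s ^ (1 / (p - 1))) ^ (-((p - 1) / (q + 1 - p))) := by
  have hp1 : 0 < p - 1 := by linarith
  have hqp : 0 < q + 1 - p := by linarith
  set T := ∫ s in Ioi (0 : ℝ), Theta n ψ s ^ (1 / (p - 1)) with hT
  have htail : ∀ r, 0 ≤ r →
      ∫ s in Ioi r, Theta n ψ s ^ (1 / (p - 1)) = T - ThetaInt n ψ p r := by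
    intro r hr
    rw [hT, ThetaInt, ← intervalIntegral.integral_Ioi_sub_Ioi hinc hr, sub_sub_cancel]
  have hTlim : Tendsto (ThetaInt n ψ p) atTop (𝓝 T) :=
    intervalIntegral_tendsto_integral_Ioi 0 hinc tendsto_id
  have hle : ∀ r, 0 ≤ r → ThetaInt n ψ p r ≤ T := fun r hr =>
    ge_of_tendsto hTlim (by
      filter_upwards [eventually_ge_atTop r] with s hs
      exact hψ.ThetaInt_monotoneOn hp hr (hr.trans hs) hs)
  have hTpos : 0 < T := (hψ.ThetaInt_pos hp one_pos).trans_le (hle 1 zero_le_one)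
  obtain ⟨c, hc, hcf⟩ := hf.exists_pos_le hψ hn hp hpq hcrit
    fun r hr => hle r (zero_le_one.trans hr)
  obtain ⟨l, hcl, hl⟩ := hf.exists_tendsto_of_le hψ hcf
  have hl0 : 0 < l := hc.trans_le hcl
  refine ⟨l, hl0, hl, ?_, ?_⟩
  -- `m/V` is the mean of `f^q` over a ball of diverging volume, hence has the same limit as `f^q`.
  · have hmV : Tendsto (fun r => ballMass n q ψ f r / ballVol n ψ r) atTop (𝓝 (l ^ q)) := by
      refine tendsto_div_of_deriv_div_tendsto (f' := fun r => ψ r ^ (n - 1) * f r ^ q)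
        (g' := fun r => ψ r ^ (n - 1)) ?_ ?_ ?_ ?_ hψ.tendsto_ballVol
      · filter_upwards [eventually_gt_atTop 0] with r hr using hf.hasDerivAt_ballMass hψ hr
      · filter_upwards [eventually_gt_atTop 0] with r hr using hψ.hasDerivAt_ballVol hr
      · filter_upwards [eventually_gt_atTop 0] with r hr using hψ.area_pos _ hr
      · refine (hl.rpow_const (p := q) (Or.inl hl0.ne')).congr' ?_
        filter_upwards [eventually_gt_atTop 0] with r hr
        have := (hψ.area_pos (n - 1) hr).ne'
        field_simp
    have hlhop : Tendsto (fun r => (f r - l) / (T - ThetaInt n ψ p r)) atTop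
        (𝓝 (l ^ (q / (p - 1)))) := by
      refine HasDerivAt.lhopital_zero_atTop
        (f' := fun r => -(ballMass n q ψ f r / ψ r ^ (n - 1)) ^ (1 / (p - 1)))
        (g' := fun r => -Theta n ψ r ^ (1 / (p - 1))) ?_ ?_ ?_ ?_ ?_ ?_
      · filter_upwards [eventually_gt_atTop 0] with r hr using (hf.hasDerivAt r hr).sub_const l
      · filter_upwards [eventually_gt_atTop 0] with r hr
          using (hψ.hasDerivAt_ThetaInt hp hr).const_sub T
      · filter_upwards [eventually_gt_atTop 0] with r hr
          using neg_ne_zero.2 (Real.rpow_pos_of_pos (hψ.Theta_pos hr) _).ne'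
      · simpa using hl.sub_const l
      · simpa using hTlim.const_sub T
      · have := hmV.rpow_const (p := 1 / (p - 1)) (Or.inl (Real.rpow_pos_of_pos hl0 q).ne')
        rw [← Real.rpow_mul hl0.le, mul_one_div] at this
        refine this.congr' ?_
        filter_upwards [eventually_gt_atTop 0] with r hr
        have := (Real.rpow_pos_of_pos (hψ.Theta_pos (n := n) hr) (1 / (p - 1))).ne'
        rw [hf.rpow_ballMass_div hψ hr]
        field_simp
    refine hlhop.congr' ?_
    filter_upwards [eventually_ge_atTop 0] with r hr
    rw [htail r hr, inv_mul_eq_div]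
  · have h1 : (q + 1 - p) / (p - 1) * T ≤ l ^ (-((q + 1 - p) / (p - 1))) := by
      refine le_of_tendsto_of_tendsto (hTlim.const_mul _) (hl.rpow_const (Or.inl hl0.ne')) ?_
      filter_upwards [eventually_ge_atTop 0] with r hr
      exact hf.ThetaInt_le_rpow_neg hψ hp hpq hr
    -- Raising to the power `-1/α` reverses the inequality and isolates `l`.
    have h2 := Real.rpow_le_rpow_of_nonpos (by positivity) h1
      (neg_nonpos.2 (div_pos hp1 hqp).le : -((p - 1) / (q + 1 - p)) ≤ 0)
    rw [← Real.rpow_mul hl0.le, Real.mul_rpow (by positivity) hTpos.le,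
      ← inv_div (p - 1), Real.inv_rpow (by positivity), Real.rpow_neg (by positivity),
      inv_inv] at h2
    rwa [show -((p - 1) / (q + 1 - p))⁻¹ * -((p - 1) / (q + 1 - p)) = 1 by field_simp,
      Real.rpow_one] at h2

/-- On a stochastically complete model with `Θ' → 0`, `Θ |f'| / f` vanishes at infinity. -/
theorem tendsto_Theta_mul_logDeriv (hn : 2 ≤ n) (hp : 1 < p) (hpq : p < q + 1)
    (hcrit : 1 / (n : ℝ) ≤ 1 / p - 1 / (q + 1)) (hcomp : PStochasticallyComplete n ψ p)
    (hgrowth : StretchedExponentialGrowth ψ ∨ SuperExponentialGrowth ψ) :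
    Tendsto (fun r => Theta n ψ r
      * ((ballMass n q ψ f r / ψ r ^ (n - 1)) ^ (1 / (p - 1)) / f r)) atTop (𝓝 0) := by
  have hn0 : n ≠ 0 := by omega
  have hp1 : 0 < p - 1 := by linarith
  have hcpos : 0 < (q + 1 - p) / p := div_pos (by linarith) (by linarith)
  -- The quotient of derivatives is `(1 + 1/(p-1)) Θ'`, which tends to zero by the growth condition.
  have hT : Tendsto (fun r => Theta n ψ r ^ (1 + 1 / (p - 1)) / ThetaInt n ψ p r) atTop
      (𝓝 0) := by
    refine tendsto_div_of_deriv_div_tendsto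
      (f' := fun r => (1 - ((n : ℝ) - 1) * (Theta n ψ r * (deriv ψ r / ψ r)))
        * (1 + 1 / (p - 1)) * Theta n ψ r ^ (1 + 1 / (p - 1) - 1))
      (g' := fun r => Theta n ψ r ^ (1 / (p - 1))) ?_ ?_ ?_ ?_ (hψ.tendsto_ThetaInt hp hcomp)
    · filter_upwards [eventually_gt_atTop 0] with r hr
      exact (hψ.hasDerivAt_Theta hn0 hr).rpow_const (Or.inl (hψ.Theta_pos hr).ne')
    · filter_upwards [eventually_gt_atTop 0] with r hr using hψ.hasDerivAt_ThetaInt hp hr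
    · filter_upwards [eventually_gt_atTop 0] with r hr
        using Real.rpow_pos_of_pos (hψ.Theta_pos hr) _
    · have := (hψ.tendsto_deriv_Theta hn hgrowth).mul_const (1 + 1 / (p - 1))
      rw [zero_mul] at this
      refine this.congr' ?_
      filter_upwards [eventually_gt_atTop 0] with r hr
      rw [add_sub_cancel_left, mul_div_assoc,
        div_self (Real.rpow_pos_of_pos (hψ.Theta_pos hr) _).ne', mul_one]
  have hup := hT.const_mul (1 / ((q + 1 - p) / p))
  rw [mul_zero] at hup
  refine tendsto_of_tendsto_of_tendsto_of_le_of_le' tendsto_const_nhds hup ?_ ?_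
  · filter_upwards [eventually_gt_atTop 0] with r hr
    exact mul_nonneg (hψ.Theta_pos hr).le (div_nonneg (Real.rpow_nonneg
      (div_pos (hf.ballMass_pos hψ hr) (hψ.area_pos _ hr)).le _) (hf.pos r hr.le).le)
  · filter_upwards [eventually_gt_atTop 0] with r hr
    have hΘ := hψ.Theta_pos (n := n) hr
    have hI := hψ.ThetaInt_pos (n := n) hp hr
    rw [hf.rpow_ballMass_div_eq hψ hr, ← mul_div_assoc, Real.rpow_add hΘ, Real.rpow_one,
      one_div_mul_eq_div, div_div, mul_comm (ThetaInt n ψ p r)]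
    exact div_le_div_of_nonneg_left (mul_pos hΘ (Real.rpow_pos_of_pos hΘ _)).le
      (mul_pos hcpos hI) (hf.ThetaInt_le_mul_rpow hψ hn hp hpq hcrit hr)

/-- Used with `b = 2q` to make the mass diverge and with `b = q` to compare `V f^q` with `m`. -/
theorem hasDerivAt_ballVol_mul_rpow (b : ℝ) {r : ℝ} (hr : 0 < r) :
    HasDerivAt (fun r => ballVol n ψ r * f r ^ b)
      (ψ r ^ (n - 1) * f r ^ b * (1 - b * (Theta n ψ r
        * ((ballMass n q ψ f r / ψ r ^ (n - 1)) ^ (1 / (p - 1)) / f r)))) r := by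
  have hf0 := hf.pos r hr.le
  refine ((hψ.hasDerivAt_ballVol hr).mul
    ((hf.hasDerivAt r hr).rpow_const (p := b) (Or.inl hf0.ne'))).congr_deriv ?_
  rw [Real.rpow_sub_one hf0.ne', Theta_eq]
  have := (hψ.area_pos (n - 1) hr).ne'
  field_simp
  ring

/-- When `Θ |f'|/f → 0`, the function `V f^(2q)` is eventually nondecreasing, hence at least some `c
> 0`. Then `m ≥ V f^q ≥ √(c V) → ∞`; the doubled exponent leaves a factor `√V` to spare. -/
theorem tendsto_ballMass (hq : 0 ≤ q)
    (hs : Tendsto (fun r => Theta n ψ r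
      * ((ballMass n q ψ f r / ψ r ^ (n - 1)) ^ (1 / (p - 1)) / f r)) atTop (𝓝 0)) :
    Tendsto (ballMass n q ψ f) atTop atTop := by
  have h1 := (hs.const_mul (2 * q)).const_sub 1
  rw [mul_zero, sub_zero] at h1
  obtain ⟨a, ha⟩ := eventually_atTop.1 ((h1.eventually_const_lt one_pos).and (eventually_gt_atTop 0))
  have hmono := monotoneOn_Ioi_of_hasDerivAt_nonneg (a := a)
    (fun r hr => hf.hasDerivAt_ballVol_mul_rpow hψ (2 * q) (ha r hr.le).2)
    fun r hr => mul_nonneg (mul_nonneg (hψ.area_pos _ (ha r hr.le).2).le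
      (Real.rpow_nonneg (hf.pos r (ha r hr.le).2.le).le _)) (ha r hr.le).1.le
  have ha1 := (ha (a + 1) (by linarith)).2
  set c := ballVol n ψ (a + 1) * f (a + 1) ^ (2 * q) with hc
  have hcpos : 0 < c := mul_pos (hψ.ballVol_pos ha1) (Real.rpow_pos_of_pos (hf.pos _ ha1.le) _)
  refine tendsto_atTop_mono' _ ?_
    (Real.tendsto_sqrt_atTop.comp ((hψ.tendsto_ballVol (n := n)).const_mul_atTop hcpos))
  filter_upwards [eventually_ge_atTop (a + 1)] with r hr
  have hr0 := (ha r (by linarith)).2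
  refine le_trans ?_ (hf.ballVol_mul_le_ballMass hψ hq hr0)
  have hV := hψ.ballVol_pos (n := n) hr0
  have hfr := hf.pos r hr0.le
  have h2 : c ≤ ballVol n ψ r * f r ^ (2 * q) :=
    hmono (show a < a + 1 by linarith) (show a < r by linarith) hr
  refine Real.sqrt_le_iff.2 ⟨mul_nonneg hV.le (Real.rpow_nonneg hfr.le _), ?_⟩
  rw [mul_comm 2 q, Real.rpow_mul hfr.le, Real.rpow_two] at h2
  nlinarith

/-- Asymptotics on stochastically complete models. -/
theorem asymptotics_of_complete (hn : 2 ≤ n) (hp : 1 < p) (hpq : p < q + 1)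
    (hcrit : 1 / (n : ℝ) ≤ 1 / p - 1 / (q + 1)) (hcomp : PStochasticallyComplete n ψ p)
    (hgrowth : StretchedExponentialGrowth ψ ∨ SuperExponentialGrowth ψ) :
    Tendsto (fun r : ℝ => (∫ s in (0 : ℝ)..r, Theta n ψ s ^ (1 / (p - 1)))
        ^ ((p - 1) / (q + 1 - p)) * f r)
      atTop (𝓝 (((p - 1) / (q + 1 - p)) ^ ((p - 1) / (q + 1 - p)))) := by
  have hp1 : 0 < p - 1 := by linarith
  have hqp : 0 < q + 1 - p := by linarith
  have hs := hf.tendsto_Theta_mul_logDeriv hψ hn hp hpq hcrit hcomp hgrowth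
  -- The quotient of derivatives is `1 - q Θ |f'|/f`.
  have hk : Tendsto (fun r => ballVol n ψ r * f r ^ q / ballMass n q ψ f r) atTop (𝓝 1) := by
    refine tendsto_div_of_deriv_div_tendsto
      (f' := fun r => ψ r ^ (n - 1) * f r ^ q * (1 - q * (Theta n ψ r
        * ((ballMass n q ψ f r / ψ r ^ (n - 1)) ^ (1 / (p - 1)) / f r))))
      (g' := fun r => ψ r ^ (n - 1) * f r ^ q) ?_ ?_ ?_ ?_
      (hf.tendsto_ballMass hψ (by linarith) hs)
    · filter_upwards [eventually_gt_atTop 0] with r hr using hf.hasDerivAt_ballVol_mul_rpow hψ q hr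
    · filter_upwards [eventually_gt_atTop 0] with r hr using hf.hasDerivAt_ballMass hψ hr
    · filter_upwards [eventually_gt_atTop 0] with r hr
        using mul_pos (hψ.area_pos _ hr) (Real.rpow_pos_of_pos (hf.pos r hr.le) _)
    · have := (hs.const_mul q).const_sub 1
      rw [mul_zero, sub_zero] at this
      refine this.congr' ?_
      filter_upwards [eventually_gt_atTop 0] with r hr
      rw [mul_div_cancel_left₀ _
        (mul_pos (hψ.area_pos (n - 1) hr) (Real.rpow_pos_of_pos (hf.pos r hr.le) q)).ne']
  have hh : Tendsto (fun r => (ballMass n q ψ f r / (ballVol n ψ r * f r ^ q)) ^ (1 / (p - 1)))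
      atTop (𝓝 1) := by
    have := (hk.inv₀ one_ne_zero).rpow_const (p := 1 / (p - 1)) (Or.inl (by simp))
    simpa using this
  have hα : Tendsto (fun r => f r ^ (-((q + 1 - p) / (p - 1))) / ThetaInt n ψ p r) atTop
      (𝓝 ((q + 1 - p) / (p - 1))) := by
    refine tendsto_div_of_deriv_div_tendsto
      (f' := fun r => (q + 1 - p) / (p - 1)
        * (ballMass n q ψ f r / (ballVol n ψ r * f r ^ q)) ^ (1 / (p - 1))
        * Theta n ψ r ^ (1 / (p - 1)))
      (g' := fun r => Theta n ψ r ^ (1 / (p - 1))) ?_ ?_ ?_ ?_ (hψ.tendsto_ThetaInt hp hcomp)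
    · filter_upwards [eventually_gt_atTop 0] with r hr using hf.hasDerivAt_rpow_neg hψ hp hr
    · filter_upwards [eventually_gt_atTop 0] with r hr using hψ.hasDerivAt_ThetaInt hp hr
    · filter_upwards [eventually_gt_atTop 0] with r hr
        using Real.rpow_pos_of_pos (hψ.Theta_pos hr) _
    · have := hh.const_mul ((q + 1 - p) / (p - 1))
      rw [mul_one] at this
      refine this.congr' ?_
      filter_upwards [eventually_gt_atTop 0] with r hr
      rw [mul_div_assoc, div_self (Real.rpow_pos_of_pos (hψ.Theta_pos hr) _).ne', mul_one]
  have hfin := hα.rpow_const (p := -((p - 1) / (q + 1 - p)))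
    (Or.inl (div_pos hqp hp1).ne')
  have e0 : ((q + 1 - p) / (p - 1)) ^ (-((p - 1) / (q + 1 - p)))
      = ((p - 1) / (q + 1 - p)) ^ ((p - 1) / (q + 1 - p)) := by
    rw [Real.rpow_neg (div_pos hqp hp1).le, ← Real.inv_rpow (div_pos hqp hp1).le, inv_div]
  rw [e0] at hfin
  refine hfin.congr' ?_
  filter_upwards [eventually_gt_atTop 0] with r hr
  have hI := hψ.ThetaInt_pos (n := n) hp hr
  have hfr := hf.pos r hr.le
  rw [Real.div_rpow (Real.rpow_nonneg hfr.le _) hI.le, ← Real.rpow_mul hfr.le,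
    Real.rpow_neg hI.le, div_inv_eq_mul,
    show -((q + 1 - p) / (p - 1)) * -((p - 1) / (q + 1 - p)) = 1 by field_simp, Real.rpow_one,
    mul_comm]
  rfl

end IsRadialODESolution

end ModelManifold

namespace ModelManifold

variable {n : ℕ}

/-! ### Radial functions -/

/-- Constancy of `η` near zero hides the singularity of the norm at the origin. -/
theorem contDiff_comp_norm {k : ℕ∞} {η : ℝ → ℝ} (hη : ContDiff ℝ k η) {c : ℝ}
    (h0 : ∀ᶠ t in 𝓝 0, η t = c) : ContDiff ℝ k fun x : Space n => η ‖x‖ := by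
  refine contDiff_iff_contDiffAt.2 fun x => ?_
  rcases eq_or_ne x 0 with rfl | hx
  · refine (contDiffAt_const (c := c)).congr_of_eventuallyEq ?_
    have : Tendsto (fun x : Space n => ‖x‖) (𝓝 0) (𝓝 0) := by
      simpa using (continuous_norm (E := Space n)).tendsto 0
    exact this.eventually h0
  · exact hη.contDiffAt.comp x (contDiffAt_norm ℝ hx)

theorem hasCompactSupport_comp_norm {η : ℝ → ℝ} {R : ℝ} (h : ∀ t, R < t → η t = 0) :
    HasCompactSupport fun x : Space n => η ‖x‖ := by
  refine HasCompactSupport.of_support_subset_isCompact (isCompact_closedBall (0 : Space n) R) ?_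
  intro x hx
  by_contra hxR
  rw [mem_closedBall_zero_iff, not_le] at hxR
  exact hx (h _ hxR)

theorem hasFDerivAt_norm {x : Space n} (hx : x ≠ 0) :
    HasFDerivAt (fun y : Space n => ‖y‖) (innerSL ℝ (‖x‖⁻¹ • x)) x := by
  have hx' : ‖x‖ ≠ 0 := norm_ne_zero_iff.2 hx
  have h1 := (hasStrictFDerivAt_norm_sq x).hasFDerivAt.sqrt (pow_ne_zero 2 hx')
  simp only [Real.sqrt_sq (norm_nonneg _)] at h1
  refine h1.congr_fderiv ?_
  ext v
  simp
  field_simp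

theorem hasFDerivAt_comp_norm {η : ℝ → ℝ} {x : Space n} (hx : x ≠ 0) {d : ℝ}
    (hη : HasDerivAt η d ‖x‖) :
    HasFDerivAt (fun y : Space n => η ‖y‖) (d • innerSL ℝ (‖x‖⁻¹ • x)) x :=
  hη.comp_hasFDerivAt x (hasFDerivAt_norm hx)

theorem exists_linearIsometryEquiv_apply_eq {x y : Space n} (h : ‖x‖ = ‖y‖) :
    ∃ R : Space n ≃ₗᵢ[ℝ] Space n, R x = y :=
  ⟨_, Submodule.reflection_sub h⟩

/-- The gradient of a smooth radial function is radial. -/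
theorem fderiv_eq_of_radial {U : Space n → ℝ} (hU : Differentiable ℝ U)
    (hrad : ∀ x y, ‖x‖ = ‖y‖ → U x = U y) {e : Space n} (he : ‖e‖ = 1) {x : Space n} (hx : x ≠ 0)
    (v : Space n) :
    fderiv ℝ U x v = fderiv ℝ U (‖x‖ • e) e * inner ℝ (‖x‖⁻¹ • x) v := by
  have hx' : ‖x‖ ≠ 0 := norm_ne_zero_iff.2 hx
  have hline : ∀ y w : Space n, HasDerivAt (fun t : ℝ => U (y + t • w)) (fderiv ℝ U y w) 0 := by
    intro y w
    have h1 : HasDerivAt (fun t : ℝ => y + t • w) w 0 := by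
      simpa using ((hasDerivAt_id (0 : ℝ)).smul_const w).const_add y
    have h2 : HasFDerivAt U (fderiv ℝ U y) (y + (0 : ℝ) • w) := by
      simpa using (hU y).hasFDerivAt
    exact h2.comp_hasDerivAt 0 h1
  set o : Space n := ‖x‖⁻¹ • x with ho
  have hoo : inner ℝ o o = (1 : ℝ) := by
    rw [real_inner_self_eq_norm_sq, ho, norm_smul, norm_inv, norm_norm, inv_mul_cancel₀ hx', one_pow]
  have hxo : x = ‖x‖ • o := by rw [ho, smul_smul, mul_inv_cancel₀ hx', one_smul]
  have hon : ‖o‖ = 1 := by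
    rw [real_inner_self_eq_norm_sq] at hoo
    nlinarith [norm_nonneg o, sq_nonneg (‖o‖ - 1)]
  have hrad1 : fderiv ℝ U x o = fderiv ℝ U (‖x‖ • e) e := by
    refine (hline x o).unique ((hline (‖x‖ • e) e).congr_of_eventuallyEq
      (Eventually.of_forall fun t => hrad _ _ ?_))
    conv_lhs => rw [hxo]
    rw [← add_smul, ← add_smul, norm_smul _ o, norm_smul _ e, hon, he]
  -- For `w ⟂ x` the points `x + t w` and `x - t w` have equal norm, so the derivative along `w`
  -- equals its own negative.
  have hperp : fderiv ℝ U x (v - inner ℝ o v • o) = 0 := by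
    set w := v - inner ℝ o v • o with hw
    have how : inner ℝ x w = (0 : ℝ) := by
      rw [hxo, inner_smul_left, hw, inner_sub_right, inner_smul_right, hoo]
      simp
    have h1 := hline x w
    have h2 := hline x (-w)
    have h3 : (fun t : ℝ => U (x + t • w)) = fun t : ℝ => U (x + t • -w) := by
      funext t
      refine hrad _ _ ?_
      rw [← sq_eq_sq₀ (norm_nonneg _) (norm_nonneg _), norm_add_sq_real, norm_add_sq_real,
        inner_smul_right, inner_smul_right, inner_neg_right, how, norm_smul, norm_smul, norm_neg]
      simp
    rw [h3] at h1
    have h4 := h1.unique h2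
    rw [map_neg] at h4
    linarith
  rw [map_sub, map_smul, hrad1, smul_eq_mul, sub_eq_zero] at hperp
  rw [hperp, mul_comm]

/-! ### Radial mollifiers -/

/-- A sequence of bump functions on the line shrinking to the origin. -/
def lineBump (k : ℕ) : ContDiffBump (0 : ℝ) where
  rIn := 1 / (k + 1)
  rOut := 2 / (k + 1)
  rIn_pos := by positivity
  rIn_lt_rOut := by gcongr; norm_num

/-- A sequence of smooth radial bump functions shrinking to the origin. -/
def radialBump (n k : ℕ) (x : Space n) : ℝ := lineBump k ‖x‖

theorem contDiff_radialBump (k : ℕ) : ContDiff ℝ ∞ (radialBump n k) :=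
  contDiff_comp_norm (lineBump k).contDiff (c := 1) (lineBump k).eventuallyEq_one

theorem support_radialBump (k : ℕ) :
    Function.support (radialBump n k) = Metric.ball 0 (lineBump k).rOut := by
  ext x
  have : radialBump n k x ≠ 0 ↔ ‖x‖ ∈ Function.support (lineBump k) := Iff.rfl
  rw [Function.mem_support, this, (lineBump k).support_eq]
  simp

theorem hasCompactSupport_radialBump (k : ℕ) : HasCompactSupport (radialBump n k) :=
  HasCompactSupport.of_support_subset_isCompact (isCompact_closedBall 0 (lineBump k).rOut)
    ((support_radialBump k).subset.trans Metric.ball_subset_closedBall)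

theorem integrable_radialBump (k : ℕ) : Integrable (radialBump n k) :=
  (contDiff_radialBump k).continuous.integrable_of_hasCompactSupport
    (hasCompactSupport_radialBump k)

theorem radialBump_nonneg (k : ℕ) (x : Space n) : 0 ≤ radialBump n k x := (lineBump k).nonneg

theorem radialBump_le_one (k : ℕ) (x : Space n) : radialBump n k x ≤ 1 := (lineBump k).le_one

/-- The bump is one on the ball of radius `rIn = rOut/2`, whence the factor `2^n`. This bounds the
normalized kernels by a fixed multiple of the inverse volume of their supporting ball. -/
theorem measure_closedBall_div_le_integral_radialBump (k : ℕ) :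
    volume.real (Metric.closedBall (0 : Space n) (lineBump k).rOut) / 2 ^ n
      ≤ ∫ x, radialBump n k x := by
  have h1 : volume.real (Metric.closedBall (0 : Space n) (lineBump k).rOut) / 2 ^ n
      = volume.real (Metric.closedBall (0 : Space n) (lineBump k).rIn) := by
    have : (lineBump k).rOut = 2 * (lineBump k).rIn := by
      simp only [lineBump]; ring
    rw [this, Measure.addHaar_real_closedBall' _ _ (mul_nonneg zero_le_two (lineBump k).rIn_pos.le),
      Measure.addHaar_real_closedBall' _ _ (lineBump k).rIn_pos.le, finrank_euclideanSpace_fin,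
      mul_pow]
    field_simp
  rw [h1, ← integral_indicator_one Metric.isClosed_closedBall.measurableSet]
  refine integral_mono ?_ (integrable_radialBump k) fun x => ?_
  · exact (integrable_indicator_iff Metric.isClosed_closedBall.measurableSet).2
      (integrableOn_const (isCompact_closedBall _ _).measure_lt_top.ne)
  · refine indicator_le' (f := 1) (g := radialBump n k) (fun y hy => ?_)
      (fun y _ => radialBump_nonneg k y) x
    refine ((lineBump k).one_of_mem_closedBall ?_).ge
    simpa using hy

theorem integral_radialBump_pos (k : ℕ) : 0 < ∫ x, radialBump n k x := by
  refine lt_of_lt_of_le ?_ (measure_closedBall_div_le_integral_radialBump k)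
  have : 0 < volume.real (Metric.closedBall (0 : Space n) (lineBump k).rOut) :=
    ENNReal.toReal_pos (Metric.measure_closedBall_pos _ _ (lineBump k).rOut_pos).ne'
      measure_closedBall_lt_top.ne
  positivity

/-- The normalized radial bump functions. -/
def mollifier (n k : ℕ) (x : Space n) : ℝ := radialBump n k x / ∫ y, radialBump n k y

theorem contDiff_mollifier (k : ℕ) : ContDiff ℝ ∞ (mollifier n k) :=
  (contDiff_radialBump k).div_const _

theorem support_mollifier (k : ℕ) :
    Function.support (mollifier n k) = Metric.ball 0 (lineBump k).rOut := by
  rw [← support_radialBump]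
  ext x
  simp [mollifier, (integral_radialBump_pos (n := n) k).ne']

theorem hasCompactSupport_mollifier (k : ℕ) : HasCompactSupport (mollifier n k) :=
  HasCompactSupport.of_support_subset_isCompact (isCompact_closedBall 0 (lineBump k).rOut)
    ((support_mollifier k).subset.trans Metric.ball_subset_closedBall)

theorem integral_mollifier (k : ℕ) : ∫ x, mollifier n k x = 1 := by
  simp only [mollifier]
  rw [integral_div, div_self (integral_radialBump_pos k).ne']

theorem mollifier_nonneg (k : ℕ) (x : Space n) : 0 ≤ mollifier n k x :=
  div_nonneg (radialBump_nonneg k x) (integral_radialBump_pos k).le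

theorem mollifier_le (k : ℕ) (x : Space n) :
    mollifier n k x ≤ 2 ^ n / volume.real (Metric.closedBall (0 : Space n) (lineBump k).rOut) := by
  have h0 : 0 < volume.real (Metric.closedBall (0 : Space n) (lineBump k).rOut) :=
    ENNReal.toReal_pos (Metric.measure_closedBall_pos _ _ (lineBump k).rOut_pos).ne'
      measure_closedBall_lt_top.ne
  have h1 := measure_closedBall_div_le_integral_radialBump (n := n) k
  rw [mollifier, div_le_div_iff₀ (integral_radialBump_pos k) h0]
  rw [div_le_iff₀ (by positivity)] at h1
  nlinarith [radialBump_le_one k x]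

theorem mollifier_congr (k : ℕ) {x y : Space n} (h : ‖x‖ = ‖y‖) :
    mollifier n k x = mollifier n k y := by
  simp only [mollifier, radialBump, h]

theorem tendsto_lineBump_rOut : Tendsto (fun k => (lineBump k).rOut) atTop (𝓝[>] 0) := by
  refine tendsto_nhdsWithin_iff.2 ⟨?_, Eventually.of_forall fun k => (lineBump k).rOut_pos⟩
  have := (tendsto_one_div_add_atTop_nhds_zero_nat (𝕜 := ℝ)).const_mul 2
  rw [mul_zero] at this
  refine this.congr fun k => ?_
  simp [lineBump, div_eq_mul_inv]

/-- The regularization of `w` by radial mollifiers. -/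
def mollify (k : ℕ) (w : Space n → ℝ) (x : Space n) : ℝ := ∫ y, w y * mollifier n k (x - y)

theorem mollify_eq_convolution (k : ℕ) (w : Space n → ℝ) :
    mollify k w = convolution w (mollifier n k) (ContinuousLinearMap.mul ℝ ℝ) volume := by
  funext x
  simp [mollify, convolution_def]

/-- Convergence holds at every Lebesgue point, since the kernels are dominated by `2^n` times the
averaging kernels of shrinking balls. -/
theorem ae_tendsto_mollify {w : Space n → ℝ} (hw : LocallyIntegrable w) :
    ∀ᵐ x, Tendsto (fun k => mollify k w x) atTop (𝓝 (w x)) := by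
  filter_upwards [(Besicovitch.vitaliFamily volume).ae_tendsto_average_norm_sub hw] with x₀ h₀
  have := (h₀.comp (Besicovitch.tendsto_filterAt volume x₀)).comp tendsto_lineBump_rOut
  have key := tendsto_integral_smul_of_tendsto_average_norm_sub
    (g := fun k y => mollifier n k (x₀ - y)) (2 ^ n) this ?_ ?_ ?_ ?_
  · refine key.congr fun k => ?_
    simp only [mollify, smul_eq_mul, mul_comm]
  · filter_upwards with i using hw.integrableOn_isCompact (isCompact_closedBall _ _)
  · refine tendsto_const_nhds.congr fun k => ?_
    rw [integral_sub_left_eq_self (mollifier n k) volume x₀, integral_mollifier]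
  · filter_upwards with k
    intro y hy
    have : x₀ - y ∈ Function.support (mollifier n k) := hy
    rw [support_mollifier, mem_ball_zero_iff] at this
    rw [Metric.mem_closedBall, dist_eq_norm, norm_sub_rev]
    exact this.le
  · filter_upwards with k y
    have e : volume.real (Metric.closedBall x₀ (lineBump k).rOut)
        = volume.real (Metric.closedBall (0 : Space n) (lineBump k).rOut) := by
      simp only [measureReal_def, Measure.addHaar_closedBall_center]
    rw [abs_of_nonneg (mollifier_nonneg _ _), e]
    exact mollifier_le k _

theorem contDiff_mollify {w : Space n → ℝ} (hw : LocallyIntegrable w) (k : ℕ) :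
    ContDiff ℝ ∞ (mollify k w) := by
  rw [mollify_eq_convolution]
  exact (hasCompactSupport_mollifier k).contDiff_convolution_right _ hw (contDiff_mollifier k)

/-- Mollification commutes with weak derivatives. -/
theorem fderiv_mollify {w h : Space n → ℝ} (hw : LocallyIntegrable w) {v : Space n}
    (hwh : ∀ φ : Space n → ℝ, ContDiff ℝ ∞ φ → HasCompactSupport φ →
      ∫ x, w x * fderiv ℝ φ x v = -∫ x, h x * φ x) (k : ℕ) (x : Space n) :
    fderiv ℝ (mollify k w) x v = mollify k h x := by
  have h1 := (hasCompactSupport_mollifier (n := n) k).hasFDerivAt_convolution_right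
    (ContinuousLinearMap.mul ℝ ℝ) hw ((contDiff_mollifier k).of_le (by norm_cast)) x
  rw [mollify_eq_convolution, h1.fderiv, convolution_precompR_apply _ hw
    ((hasCompactSupport_mollifier k).fderiv ℝ)
    ((contDiff_mollifier k).continuous_fderiv (by simp))]
  have hφ : ContDiff ℝ ∞ fun y : Space n => mollifier n k (x - y) :=
    (contDiff_mollifier k).comp (contDiff_const.sub contDiff_id)
  have hφc : HasCompactSupport fun y : Space n => mollifier n k (x - y) :=
    (hasCompactSupport_mollifier k).comp_homeomorph (Homeomorph.subLeft x)
  have key := hwh _ hφ hφc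
  have hd : ∀ y : Space n, fderiv ℝ (fun y : Space n => mollifier n k (x - y)) y v
      = -fderiv ℝ (mollifier n k) (x - y) v := by
    intro y
    have h2 : HasFDerivAt (mollifier n k) (fderiv ℝ (mollifier n k) (x - y)) (x - y) :=
      ((contDiff_mollifier k).differentiable (by simp) _).hasFDerivAt
    have h3 : HasFDerivAt (fun y : Space n => x - y) (-ContinuousLinearMap.id ℝ (Space n)) y :=
      (hasFDerivAt_id y).const_sub x
    change fderiv ℝ (mollifier n k ∘ fun y => x - y) y v = _
    rw [(h2.comp y h3).fderiv]
    simp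
  simp only [hd, mul_neg, integral_neg, neg_inj] at key
  simpa [convolution_def, mollify] using key

/-- Points of equal norm are exchanged by a linear isometry, which preserves Lebesgue measure, the
kernel and, almost everywhere, `w`. -/
theorem mollify_eq_of_radial {w : Space n → ℝ}
    (hw : ∀ R : Space n ≃ₗᵢ[ℝ] Space n, ∀ᵐ x, w (R x) = w x) (k : ℕ) {x y : Space n}
    (hxy : ‖x‖ = ‖y‖) : mollify k w x = mollify k w y := by
  obtain ⟨R, rfl⟩ := exists_linearIsometryEquiv_apply_eq hxy
  have h1 : mollify k w (R x) = ∫ z, w (R z) * mollifier n k (R x - R z) :=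
    (R.measurePreserving.integral_comp R.toHomeomorph.measurableEmbedding
      fun z => w z * mollifier n k (R x - z)).symm
  rw [h1, mollify]
  refine integral_congr_ae ?_
  filter_upwards [hw R] with z hz
  rw [hz, mollifier_congr k (show ‖R x - R z‖ = ‖x - z‖ by rw [← map_sub, R.norm_map])]

/-- A locally integrable function with vanishing weak derivatives is constant. -/
theorem ae_eq_const_of_weak_deriv_zero {w : Space n → ℝ} (hw : LocallyIntegrable w)
    (h : ∀ φ : Space n → ℝ, ContDiff ℝ ∞ φ → HasCompactSupport φ → ∀ v : Space n,
      ∫ x, w x * fderiv ℝ φ x v = 0) : ∃ c, ∀ᵐ x, w x = c := by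
  have hlim := ae_tendsto_mollify hw
  obtain ⟨x₀, hx₀⟩ := hlim.exists
  refine ⟨w x₀, ?_⟩
  filter_upwards [hlim] with x hx
  refine tendsto_nhds_unique (hx.congr fun k => ?_) hx₀
  refine is_const_of_fderiv_eq_zero ((contDiff_mollify hw k).differentiable (by simp)) (fun y => ?_)
    x x₀
  ext v
  rw [fderiv_mollify hw (h := fun _ => 0) (fun φ hφ hc => by simpa using h φ hφ hc v)]
  simp [mollify]

/-- A radial function has a measurable profile, and its weak gradient is radial. -/
theorem exists_radial_gradient [NeZero n] {u : Space n → ℝ} {H : Space n → Space n}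
    (hu : LocallyIntegrable u) (hH : ∀ v, LocallyIntegrable fun x => inner ℝ (H x) v)
    (hrad : ∀ R : Space n ≃ₗᵢ[ℝ] Space n, ∀ᵐ x, u (R x) = u x)
    (hgrad : ∀ φ : Space n → ℝ, ContDiff ℝ ∞ φ → HasCompactSupport φ → ∀ v : Space n,
      ∫ x, u x * fderiv ℝ φ x v = -∫ x, inner ℝ (H x) v * φ x) :
    ∃ f g : ℝ → ℝ, Measurable f ∧ Measurable g ∧ (∀ᵐ x, u x = f ‖x‖) ∧
      ∀ᵐ x, H x = g ‖x‖ • ‖x‖⁻¹ • x := by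
  set e : Space n := EuclideanSpace.single 0 1 with he'
  have he : ‖e‖ = 1 := by simp [he']
  have hsm := fun k => contDiff_mollify hu k
  -- The upper limits along one ray are Borel functions defined for every `r`; they agree with the
  -- true limits wherever the mollifications converge.
  refine ⟨fun r => limsup (fun k => mollify k u (r • e)) atTop,
    fun r => limsup (fun k => fderiv ℝ (mollify k u) (r • e) e) atTop, ?_, ?_, ?_, ?_⟩
  · refine Measurable.limsup fun k => ?_
    exact ((hsm k).continuous.comp (by fun_prop)).measurable
  · refine Measurable.limsup fun k => ?_
    have h1 : Continuous fun r : ℝ => fderiv ℝ (mollify k u) (r • e) :=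
      ((hsm k).continuous_fderiv (by simp)).comp (by fun_prop)
    exact (h1.clm_apply continuous_const).measurable
  · filter_upwards [ae_tendsto_mollify hu] with x hx
    refine (Tendsto.limsup_eq (hx.congr fun k => ?_)).symm
    exact mollify_eq_of_radial hrad k (by simp [norm_smul, he])
  · have hall : ∀ᵐ x, ∀ i : Fin n, Tendsto (fun k =>
        mollify k (fun x => inner ℝ (H x) (EuclideanSpace.single i (1 : ℝ))) x) atTop
        (𝓝 (inner ℝ (H x) (EuclideanSpace.single i (1 : ℝ)))) :=
      ae_all_iff.2 fun i => ae_tendsto_mollify (hH _)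
    have h0 : ∀ᵐ x : Space n, x ≠ 0 := by
      have : Nontrivial (Space n) := ⟨⟨e, 0, by rw [← norm_ne_zero_iff, he]; exact one_ne_zero⟩⟩
      simp [ae_iff]
    filter_upwards [hall, h0] with x hx hx0
    have hx' : ‖x‖ ≠ 0 := norm_ne_zero_iff.2 hx0
    have hlim : ∀ v, Tendsto (fun k => fderiv ℝ (mollify k u) x v) atTop
        (𝓝 (inner ℝ (H x) v)) := by
      intro v
      -- Expanding in coordinates means only finitely many exceptional null sets arise, although `v`
      -- is arbitrary.
      have hv : v = ∑ i, v i • EuclideanSpace.single i (1 : ℝ) := by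
        have := (EuclideanSpace.basisFun (Fin n) ℝ).sum_repr v
        simpa using this.symm
      rw [hv]
      simp only [map_sum, map_smul, inner_sum, inner_smul_right, smul_eq_mul]
      refine tendsto_finsetSum _ fun i _ => Tendsto.const_mul _ ?_
      refine (hx i).congr fun k => ?_
      exact (fderiv_mollify hu (fun φ hφ hc => hgrad φ hφ hc _) k x).symm
    have hform : ∀ k v, fderiv ℝ (mollify k u) x v
        = fderiv ℝ (mollify k u) (‖x‖ • e) e * inner ℝ (‖x‖⁻¹ • x) v := fun k v =>
      fderiv_eq_of_radial ((hsm k).differentiable (by simp))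
        (fun y z hyz => mollify_eq_of_radial hrad k hyz) he hx0 v
    have hoo : inner ℝ (‖x‖⁻¹ • x) (‖x‖⁻¹ • x) = (1 : ℝ) := by
      rw [real_inner_self_eq_norm_sq, norm_smul, norm_inv, norm_norm, inv_mul_cancel₀ hx', one_pow]
    have hg : Tendsto (fun k => fderiv ℝ (mollify k u) (‖x‖ • e) e) atTop
        (𝓝 (inner ℝ (H x) (‖x‖⁻¹ • x))) := by
      refine (hlim (‖x‖⁻¹ • x)).congr fun k => ?_
      rw [hform, hoo, mul_one]
    rw [hg.limsup_eq]
    refine ext_inner_right ℝ fun v => ?_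
    rw [inner_smul_left]
    refine tendsto_nhds_unique (hlim v) ((hg.mul_const _).congr fun k => (hform k v).symm)

end ModelManifold

namespace ModelManifold

variable {n : ℕ} {ψ : ℝ → ℝ}

/-! ### The Riemannian volume in polar coordinates -/

instance [NeZero n] : Nontrivial (Space n) :=
  ⟨⟨EuclideanSpace.single 0 1, 0, by rw [← norm_ne_zero_iff]; simp⟩⟩

theorem ae_ne_zero [NeZero n] : ∀ᵐ x : Space n, x ≠ 0 := by simp [ae_iff]

/-- The set of points at distances in a null set from the pole is a null set. -/
theorem ae_comp_norm_iff [NeZero n] {P : ℝ → Prop} :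
    (∀ᵐ x : Space n, P ‖x‖) ↔ ∀ᵐ r ∂volume.restrict (Ioi 0), P r := by
  -- The exceptional set is null exactly when its indicator has zero integral, which polar
  -- coordinates transfer to the half line.
  set F : ℝ → ℝ := indicator {r | P r}ᶜ 1 with hF
  have hF0 : ∀ r, F r = 0 ↔ P r := fun r => by
    by_cases h : P r <;> simp [hF, h]
  have hFn : ∀ r, 0 ≤ F r := fun r => indicator_nonneg (fun _ _ => zero_le_one) r
  have hint := integral_fun_norm_addHaar (volume : Measure (Space n)) F
  have hable := integrable_fun_norm_addHaar (volume : Measure (Space n)) (f := F)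
  have hc : Module.finrank ℝ (Space n) ≠ 0 := by simp [NeZero.ne n]
  have hv : volume.real (Metric.ball (0 : Space n) 1) ≠ 0 :=
    (ENNReal.toReal_pos (Metric.measure_ball_pos _ _ one_pos).ne' measure_ball_lt_top.ne).ne'
  have hpow : ∀ r ∈ Ioi (0 : ℝ), r ^ (Module.finrank ℝ (Space n) - 1) • F r = 0 ↔ P r := by
    intro r hr
    rw [smul_eq_zero, hF0, or_iff_right (pow_pos (mem_Ioi.1 hr) _).ne']
  constructor
  · intro h
    have h0 : (fun x : Space n => F ‖x‖) =ᵐ[volume] 0 := by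
      filter_upwards [h] with x hx using (hF0 _).2 hx
    have h1 := hable.1 ((integrable_zero _ _ _).congr h0.symm)
    rw [integral_congr_ae h0] at hint
    simp only [Pi.zero_apply, integral_zero, nsmul_eq_mul, smul_eq_mul] at hint
    have h2 := ((mul_eq_zero.1 ((mul_eq_zero.1 hint.symm).resolve_left
      (Nat.cast_ne_zero.2 hc))).resolve_left hv)
    have h3 := (setIntegral_eq_zero_iff_of_nonneg_ae (by
      filter_upwards [ae_restrict_mem measurableSet_Ioi] with r hr
      exact mul_nonneg (pow_nonneg (mem_Ioi.1 hr).le _) (hFn r)) h1).1 h2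
    filter_upwards [h3, ae_restrict_mem measurableSet_Ioi] with r hr hr0
    exact (hpow r hr0).1 hr
  · intro h
    have h0 : (fun r => r ^ (Module.finrank ℝ (Space n) - 1) • F r)
        =ᵐ[volume.restrict (Ioi 0)] 0 := by
      filter_upwards [h, ae_restrict_mem measurableSet_Ioi] with r hr hr0
        using (hpow r hr0).2 hr
    have h1 := hable.2 ((integrable_zero _ _ _).congr h0.symm)
    rw [integral_congr_ae h0] at hint
    simp only [Pi.zero_apply, integral_zero, smul_zero] at hint
    filter_upwards [(integral_eq_zero_iff_of_nonneg (fun x => hFn ‖x‖) h1).1 hint] with x hx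
      using (hF0 _).1 hx

/-- The radial profile of `warp`. -/
def warpProfile (ψ : ℝ → ℝ) (r : ℝ) : ℝ :=
  open Classical in if r = 0 then 1 else ψ r / r

theorem warp_eq (ψ : ℝ → ℝ) (x : Space n) : warp ψ x = warpProfile ψ ‖x‖ := by
  simp [warp, warpProfile]

theorem pow_mul_warpProfile_pow {r : ℝ} (hr : r ≠ 0) (k : ℕ) :
    r ^ k * warpProfile ψ r ^ k = ψ r ^ k := by
  rw [warpProfile, if_neg hr, ← mul_pow, mul_div_cancel₀ _ hr]

/-! ### The metric -/

/-- The Euclidean representative of the 1-form `g(G, ·)` at `x`. -/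
def flat (ψ : ℝ → ℝ) (x G : Space n) : Space n :=
  inner ℝ (‖x‖⁻¹ • x) G • (‖x‖⁻¹ • x)
    + warp ψ x ^ 2 • (G - inner ℝ (‖x‖⁻¹ • x) G • (‖x‖⁻¹ • x))

theorem inner_flat (x G v : Space n) :
    inner ℝ (flat ψ x G) v = metric ψ x G v := by
  simp only [flat, metric, inner_add_left, inner_sub_left, inner_smul_left, RCLike.conj_to_real]

theorem inner_unit_self {x : Space n} (hx : x ≠ 0) :
    inner ℝ (‖x‖⁻¹ • x) (‖x‖⁻¹ • x) = (1 : ℝ) := by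
  rw [real_inner_self_eq_norm_sq, norm_smul, norm_inv, norm_norm,
    inv_mul_cancel₀ (norm_ne_zero_iff.2 hx), one_pow]

theorem metricNorm_smul_unit {x : Space n} (hx : x ≠ 0) (c : ℝ) :
    metricNorm ψ x (c • ‖x‖⁻¹ • x) = |c| := by
  have hoo := inner_unit_self hx
  rw [metricNorm, metric]
  set o := ‖x‖⁻¹ • x
  simp only [inner_smul_left, inner_smul_right, hoo, RCLike.conj_to_real, mul_one, sub_self,
    mul_zero, add_zero]
  exact Real.sqrt_mul_self_eq_abs c

namespace IsCartanHadamardModel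

variable (hψ : IsCartanHadamardModel ψ)
include hψ

theorem one_le_warp (x : Space n) : 1 ≤ warp ψ x := by
  rw [warp]
  split_ifs with h
  · rfl
  · rw [one_le_div (norm_pos_iff.2 h)]
    exact hψ.self_le (norm_nonneg x)

theorem warp_pos (x : Space n) : 0 < warp ψ x := one_pos.trans_le (hψ.one_le_warp x)

theorem warp_le {x : Space n} {R : ℝ} (hR : 0 < R) (hx : ‖x‖ ≤ R) : warp ψ x ≤ ψ R / R := by
  rw [warp]
  split_ifs with h
  · rw [one_le_div hR]
    exact hψ.self_le hR.le
  · exact hψ.div_le_div_of_le (norm_pos_iff.2 h) hx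

theorem measurable_warp : Measurable (warp ψ : Space n → ℝ) := by
  refine measurable_of_continuousOn_compl_singleton 0 ?_
  have : ContinuousOn (fun x : Space n => ψ ‖x‖ / ‖x‖) {0}ᶜ :=
    (hψ.continuousOn.comp continuous_norm.continuousOn fun x _ => norm_nonneg x).div
      continuous_norm.continuousOn fun x hx => norm_ne_zero_iff.2 hx
  refine this.congr fun x hx => ?_
  rw [warp, if_neg (show x ≠ 0 from hx)]

theorem measurable_density :
    Measurable fun x : Space n => ENNReal.ofReal (warp ψ x ^ (n - 1)) :=
  (hψ.measurable_warp.pow_const _).ennreal_ofReal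

/-- The density is at least one because `ψ(r) ≥ r`; local integrability and null sets thus pass to
Lebesgue measure. -/
theorem volume_le_vol : (volume : Measure (Space n)) ≤ vol n ψ := by
  rw [vol]
  conv_lhs => rw [← withDensity_one (μ := (volume : Measure (Space n)))]
  refine withDensity_mono (Eventually.of_forall fun x => ?_)
  rw [Pi.one_apply, ENNReal.one_le_ofReal]
  exact one_le_pow₀ (hψ.one_le_warp x)

theorem ae_vol_iff {P : Space n → Prop} : (∀ᵐ x ∂vol n ψ, P x) ↔ ∀ᵐ x, P x :=
  ⟨fun h => (Measure.absolutelyContinuous_of_le hψ.volume_le_vol).ae_le h,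
    fun h => (withDensity_absolutelyContinuous _ _).ae_le h⟩

theorem integrable_vol_iff {F : Space n → ℝ} :
    Integrable F (vol n ψ) ↔ Integrable fun x => warp ψ x ^ (n - 1) * F x := by
  rw [vol, integrable_withDensity_iff_integrable_smul' hψ.measurable_density (by simp)]
  refine integrable_congr (Eventually.of_forall fun x => ?_)
  simp only [smul_eq_mul]
  rw [ENNReal.toReal_ofReal (pow_nonneg (hψ.warp_pos x).le _)]

theorem integral_vol (F : Space n → ℝ) :
    ∫ x, F x ∂vol n ψ = ∫ x, warp ψ x ^ (n - 1) * F x := by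
  rw [vol, integral_withDensity_eq_integral_toReal_smul hψ.measurable_density (by simp)]
  refine integral_congr_ae (Eventually.of_forall fun x => ?_)
  simp only [smul_eq_mul]
  rw [ENNReal.toReal_ofReal (pow_nonneg (hψ.warp_pos x).le _)]

theorem integrable_comp_norm_vol [NeZero n] {F : ℝ → ℝ} :
    Integrable (fun x : Space n => F ‖x‖) (vol n ψ)
      ↔ IntegrableOn (fun r => ψ r ^ (n - 1) * F r) (Ioi 0) := by
  rw [hψ.integrable_vol_iff]
  simp only [warp_eq]
  rw [integrable_fun_norm_addHaar (volume : Measure (Space n))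
    (f := fun r => warpProfile ψ r ^ (n - 1) * F r), finrank_euclideanSpace_fin]
  refine integrableOn_congr_fun (fun r hr => ?_) measurableSet_Ioi
  rw [smul_eq_mul, ← mul_assoc, pow_mul_warpProfile_pow (mem_Ioi.1 hr).ne']

theorem integral_comp_norm_vol [NeZero n] (F : ℝ → ℝ) :
    ∫ x : Space n, F ‖x‖ ∂vol n ψ = (n * volume.real (Metric.ball (0 : Space n) 1))
      * ∫ r in Ioi 0, ψ r ^ (n - 1) * F r := by
  rw [hψ.integral_vol]
  simp only [warp_eq]
  rw [integral_fun_norm_addHaar (volume : Measure (Space n))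
    (fun r => warpProfile ψ r ^ (n - 1) * F r), finrank_euclideanSpace_fin, nsmul_eq_mul,
    smul_eq_mul, mul_assoc]
  congr 2
  refine setIntegral_congr_fun measurableSet_Ioi fun r hr => ?_
  simp only [smul_eq_mul]
  rw [← mul_assoc, pow_mul_warpProfile_pow (mem_Ioi.1 hr).ne']

/-- The Euclidean norm of the differential is controlled by the Riemannian one. -/
theorem norm_flat_le (x G : Space n) : ‖flat ψ x G‖ ≤ warp ψ x * metricNorm ψ x G := by
  have hw := hψ.one_le_warp x
  rw [metricNorm, ← Real.sqrt_sq (hψ.warp_pos x).le, ← Real.sqrt_mul (sq_nonneg _)]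
  refine Real.le_sqrt_of_sq_le ?_
  rw [← real_inner_self_eq_norm_sq]
  rcases eq_or_ne x 0 with rfl | hx
  · simp [flat, metric, warp]
  have hoo := inner_unit_self hx
  set o := ‖x‖⁻¹ • x with ho
  set a := warp ψ x with ha
  have hcs : inner ℝ o G * inner ℝ o G ≤ inner ℝ G G := by
    have := real_inner_mul_inner_self_le o G
    rwa [hoo, one_mul] at this
  -- Tangential parts are scaled by `a²` and radial parts by one, while the bound wanted scales the
  -- radial part by `a² ≥ 1`.
  have e1 : inner ℝ (flat ψ x G) (flat ψ x G) = inner ℝ o G * inner ℝ o G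
      + a ^ 2 * (a ^ 2 * (inner ℝ G G - inner ℝ o G * inner ℝ o G)) := by
    rw [flat, ← ho, ← ha]
    simp only [inner_add_left, inner_sub_left, inner_smul_left, RCLike.conj_to_real,
      inner_add_right, inner_sub_right, inner_smul_right, hoo, real_inner_comm o G]
    ring
  rw [e1, metric]
  change _ ≤ a ^ 2 * (inner ℝ o G * inner ℝ o G + a ^ 2 * (inner ℝ G G - inner ℝ o G * inner ℝ o G))
  have h1 : (1 : ℝ) ≤ a ^ 2 := one_le_pow₀ hw
  nlinarith [mul_self_nonneg (inner ℝ o G : ℝ)]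

theorem eq_of_flat_eq {x G : Space n} (hx : x ≠ 0) {c : ℝ}
    (h : flat ψ x G = c • ‖x‖⁻¹ • x) : G = c • ‖x‖⁻¹ • x := by
  have hoo := inner_unit_self hx
  have h1 : inner ℝ (‖x‖⁻¹ • x) (flat ψ x G) = c := by
    rw [h, inner_smul_right, hoo, mul_one]
  set o := ‖x‖⁻¹ • x with ho
  have h2 : inner ℝ o G = c := by
    rw [flat, ← ho] at h1
    simp only [inner_add_right, inner_sub_right, inner_smul_right, hoo] at h1
    linarith
  rw [flat, ← ho, h2, add_eq_left, smul_eq_zero,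
    or_iff_right (pow_pos (hψ.warp_pos x) 2).ne', sub_eq_zero] at h
  exact h

end IsCartanHadamardModel

end ModelManifold

namespace ModelManifold

variable {n : ℕ} {p q : ℝ} {ψ : ℝ → ℝ} {u : Space n → ℝ} {G : Space n → Space n}

/-! ### From weak radial solutions to the radial equation -/

theorem IsLocalSobolev.locallyIntegrable (hψ : IsCartanHadamardModel ψ) (hp : 1 < p)
    (hu : IsLocalSobolev ψ p u G) : LocallyIntegrable u := by
  refine locallyIntegrable_iff.2 fun K hK => ?_
  have : IsFiniteMeasure (volume.restrict K) := isFiniteMeasure_restrict.2 hK.measure_lt_top.ne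
  refine MemLp.integrable (q := ENNReal.ofReal p) (by simpa using hp.le) ?_
  exact (hu.memLp K hK).mono_measure (Measure.restrict_mono_measure hψ.volume_le_vol K)

theorem IsLocalSobolev.locallyIntegrable_flat (hψ : IsCartanHadamardModel ψ) (hp : 1 < p)
    (hu : IsLocalSobolev ψ p u G) (v : Space n) :
    LocallyIntegrable fun x => inner ℝ (flat ψ x (G x)) v := by
  refine locallyIntegrable_iff.2 fun K hK => ?_
  have : IsFiniteMeasure (volume.restrict K) := isFiniteMeasure_restrict.2 hK.measure_lt_top.ne
  have hle := Measure.restrict_mono_measure hψ.volume_le_vol K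
  have hG : AEStronglyMeasurable G volume := hu.aestronglyMeasurable_grad.mono_measure
    hψ.volume_le_vol
  have hx : AEStronglyMeasurable (fun x : Space n => ‖x‖⁻¹ • x) volume :=
    (continuous_norm.measurable.inv.smul measurable_id).aestronglyMeasurable
  have hmeas : AEStronglyMeasurable (fun x => flat ψ x (G x)) volume := by
    have h1 := (hx.inner (𝕜 := ℝ) hG).smul hx
    exact h1.add ((hψ.measurable_warp.pow_const 2).aestronglyMeasurable.smul (hG.sub h1))
  obtain ⟨R, hR, hKR⟩ := hK.isBounded.exists_pos_norm_le
  have hint : Integrable (fun x => metricNorm ψ x (G x)) (volume.restrict K) :=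
    ((hu.memLp_grad K hK).mono_measure hle).integrable (by simpa using hp.le)
  refine ((hint.const_mul (ψ R / R)).mul_const ‖v‖).mono'
    (hmeas.inner (𝕜 := ℝ) aestronglyMeasurable_const).restrict ?_
  filter_upwards [ae_restrict_mem hK.measurableSet] with x hxK
  refine (norm_inner_le_norm _ _).trans (mul_le_mul_of_nonneg_right ?_ (norm_nonneg v))
  exact (hψ.norm_flat_le x (G x)).trans
    (mul_le_mul_of_nonneg_right (hψ.warp_le hR (hKR x hxK)) (Real.sqrt_nonneg _))

/-- The one-dimensional content of the notion of radial weak solution: `f` is the profile of `u`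
and `g` that of its radial derivative. -/
structure IsWeakProfile (ψ : ℝ → ℝ) (p q : ℝ) (u : Space n → ℝ) (f g : ℝ → ℝ) : Prop where
  measurable : Measurable f
  measurable_deriv : Measurable g
  locallyIntegrable : LocallyIntegrable u
  ae_eq : ∀ᵐ x, u x = f ‖x‖
  pos : ∀ᵐ r ∂volume.restrict (Ioi 0), 0 < f r
  bounded : ∀ R : ℝ, ∃ C, ∀ᵐ r ∂volume.restrict (Ioi 0), r ≤ R → f r ≤ C
  integrableOn : ∀ R : ℝ, IntegrableOn (fun r => ψ r ^ (n - 1) * |g r| ^ p) (Ioc 0 R)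
  locallyIntegrable_grad : ∀ v : Space n,
    LocallyIntegrable fun x : Space n => inner ℝ (g ‖x‖ • ‖x‖⁻¹ • x) v
  weakGradient : ∀ φ : Space n → ℝ, ContDiff ℝ ∞ φ → HasCompactSupport φ → ∀ v : Space n,
    ∫ x, u x * fderiv ℝ φ x v = -∫ x, inner ℝ (g ‖x‖ • ‖x‖⁻¹ • x) v * φ x
  weak : ∀ η : ℝ → ℝ, ContDiff ℝ ∞ η → (∀ᶠ t in 𝓝 0, η t = η 0) →
    (∃ R, ∀ t, R < t → η t = 0) →
    ∫ r in Ioi 0, ψ r ^ (n - 1) * (|g r| ^ (p - 2) * (g r * deriv η r))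
      = ∫ r in Ioi 0, ψ r ^ (n - 1) * (f r ^ q * η r)

/-- The Euclidean weak gradient of `u` is `flat ψ x (G x)`, so that field is shown to be radial; on
radial vectors `flat` is the identity, hence `G` is the same field. -/
theorem IsRadialSolution.exists_isWeakProfile [NeZero n] (hψ : IsCartanHadamardModel ψ)
    (hp : 1 < p) (hu : IsRadialSolution ψ p q u) : ∃ f g, IsWeakProfile ψ p q u f g := by
  obtain ⟨G, hG, hweak⟩ := hu.weak
  obtain ⟨F, hF⟩ := hu.radial
  rw [hψ.ae_vol_iff] at hF
  have hrad : ∀ R : Space n ≃ₗᵢ[ℝ] Space n, ∀ᵐ x, u (R x) = u x := by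
    intro R
    filter_upwards [hF, R.measurePreserving.quasiMeasurePreserving.ae hF] with x h1 h2
    rw [h1, h2, R.norm_map]
  obtain ⟨f, g, hfm, hgm, huf, hflat⟩ := exists_radial_gradient (hG.locallyIntegrable hψ hp)
    (fun v => hG.locallyIntegrable_flat hψ hp v) hrad (fun φ hφ hc v => by
      simp only [inner_flat]
      exact hG.isWeakGradient φ hφ hc v)
  have hGg : ∀ᵐ x, G x = g ‖x‖ • ‖x‖⁻¹ • x := by
    filter_upwards [hflat, ae_ne_zero] with x hx hx0 using hψ.eq_of_flat_eq hx0 hx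
  have hnorm : ∀ᵐ x, metricNorm ψ x (G x) = |g ‖x‖| := by
    filter_upwards [hGg, ae_ne_zero] with x hx hx0
    rw [hx, metricNorm_smul_unit hx0]
  refine ⟨f, g, hfm, hgm, hG.locallyIntegrable hψ hp, huf, ?_, ?_, ?_, ?_, ?_, ?_⟩
  · refine (ae_comp_norm_iff (n := n)).1 ?_
    filter_upwards [huf, hψ.ae_vol_iff.1 hu.pos] with x h1 h2 using h1 ▸ h2
  · intro R
    obtain ⟨C, hC⟩ := hG.bounded (Metric.closedBall 0 R) (isCompact_closedBall 0 R)
    refine ⟨C, (ae_comp_norm_iff (n := n)).1 ?_⟩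
    rw [ae_restrict_iff' Metric.isClosed_closedBall.measurableSet, hψ.ae_vol_iff] at hC
    filter_upwards [huf, hC] with x h1 h2 hxR
    rw [← h1]
    exact (le_abs_self _).trans (h2 (by simpa using hxR))
  · intro R
    have hsub : Ioc 0 R ⊆ Ioi 0 := Ioc_subset_Ioi_self
    have h1 := (hG.memLp_grad (Metric.closedBall 0 R) (isCompact_closedBall 0 R)).integrable_norm_rpow
      (by simpa using by linarith) (by simp)
    rw [ENNReal.toReal_ofReal (by linarith)] at h1
    have h2 : Integrable (fun x : Space n => indicator (Iic R) (fun r => |g r| ^ p) ‖x‖)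
        (vol n ψ) := by
      refine ((integrable_indicator_iff Metric.isClosed_closedBall.measurableSet).2 h1).congr ?_
      filter_upwards [hψ.ae_vol_iff.2 hnorm] with x hx
      by_cases hxR : ‖x‖ ≤ R
      · rw [indicator_of_mem (by simpa using hxR), indicator_of_mem (by simpa using hxR), hx,
          Real.norm_eq_abs, abs_abs]
      · rw [indicator_of_notMem (by simpa using hxR), indicator_of_notMem (by simpa using hxR)]
    refine ((hψ.integrable_comp_norm_vol.1 h2).mono_set hsub).congr_fun (fun r hr => ?_) measurableSet_Ioc
    simp only
    rw [indicator_of_mem (show r ∈ Iic R from hr.2)]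
  · intro v
    refine (locallyIntegrable_congr ?_).1 (hG.locallyIntegrable_flat hψ hp v)
    filter_upwards [hflat] with x hx
    rw [hx]
  · intro φ hφ hc v
    rw [hG.isWeakGradient φ hφ hc v]
    congr 1
    refine integral_congr_ae ?_
    filter_upwards [hflat] with x hx
    rw [← hx, inner_flat]
  · rintro η hη h0 ⟨R, hR⟩
    have h1 := hweak (fun x => η ‖x‖) (contDiff_comp_norm hη h0) (hasCompactSupport_comp_norm hR)
    have e1 : ∫ x, metricNorm ψ x (G x) ^ (p - 2) * fderiv ℝ (fun x => η ‖x‖) x (G x) ∂vol n ψ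
        = ∫ x : Space n, (fun r => |g r| ^ (p - 2) * (g r * deriv η r)) ‖x‖ ∂vol n ψ := by
      refine integral_congr_ae (hψ.ae_vol_iff.2 ?_)
      filter_upwards [hGg, hnorm, ae_ne_zero] with x hx hxn hx0
      have hd := (hasFDerivAt_comp_norm (η := η) hx0
        ((hη.differentiable (by simp)) ‖x‖).hasDerivAt).fderiv
      rw [hxn, hd, hx, _root_.smul_apply, innerSL_apply_apply, inner_smul_right,
        inner_unit_self hx0, mul_one, smul_eq_mul, mul_comm (g ‖x‖)]
    have e2 : ∫ x, u x ^ q * η ‖x‖ ∂vol n ψ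
        = ∫ x : Space n, (fun r => f r ^ q * η r) ‖x‖ ∂vol n ψ := by
      refine integral_congr_ae (hψ.ae_vol_iff.2 ?_)
      filter_upwards [huf] with x hx
      rw [hx]
    have hv : volume.real (Metric.ball (0 : Space n) 1) ≠ 0 :=
      (ENNReal.toReal_pos (Metric.measure_ball_pos _ _ one_pos).ne' measure_ball_lt_top.ne).ne'
    -- The area of the unit sphere, `n` times the volume of the unit ball, cancels from both sides.
    exact mul_left_cancel₀ (mul_ne_zero (Nat.cast_ne_zero.2 (NeZero.ne n)) hv)
      ((hψ.integral_comp_norm_vol fun r => |g r| ^ (p - 2) * (g r * deriv η r)).symm.trans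
        ((e1.symm.trans (h1.trans e2)).trans
          (hψ.integral_comp_norm_vol fun r => f r ^ q * η r)))

theorem eq_neg_rpow_of_abs_rpow_mul_eq {t w : ℝ} (hp : 1 < p) (hw : 0 ≤ w)
    (h : |t| ^ (p - 2) * t = -w) : t = -w ^ (1 / (p - 1)) := by
  have hp1 : p - 1 ≠ 0 := by linarith
  rcases eq_or_ne t 0 with rfl | ht
  · have : w = 0 := by simpa using h.symm
    rw [this, Real.zero_rpow (one_div_ne_zero hp1), neg_zero]
  · have h0 : 0 < |t| := abs_pos.2 ht
    have h1 := Real.rpow_pos_of_pos h0 (p - 2)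
    have ht0 : t ≤ 0 := by
      by_contra! hpos
      linarith [mul_pos h1 hpos]
    have h2 : |t| ^ (p - 1) = w := by
      rw [show p - 1 = p - 2 + 1 by ring, Real.rpow_add_one h0.ne']
      nth_rewrite 2 [abs_of_nonpos ht0]
      linarith
    rw [← h2, ← Real.rpow_mul h0.le, mul_one_div_cancel hp1, Real.rpow_one, abs_of_nonpos ht0,
      neg_neg]

/-! ### The flux identity for weak profiles. -/

namespace IsWeakProfile

variable {f g : ℝ → ℝ} (h : IsWeakProfile ψ p q u f g) (hψ : IsCartanHadamardModel ψ)

include h hψ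

theorem exists_ballMass_integrand_le (hq : 0 ≤ q) (R : ℝ) : ∃ C, 0 ≤ C ∧
    ∀ᵐ r ∂volume.restrict (Ioc 0 R), ‖ψ r ^ (n - 1) * f r ^ q‖ ≤ C * ψ r ^ (n - 1) := by
  obtain ⟨C, hC⟩ := h.bounded R
  refine ⟨|C| ^ q, Real.rpow_nonneg (abs_nonneg C) _, ?_⟩
  have hsub : (Ioc 0 R : Set ℝ) ⊆ Ioi 0 := Ioc_subset_Ioi_self
  filter_upwards [ae_restrict_of_ae_restrict_of_subset hsub hC,
    ae_restrict_of_ae_restrict_of_subset hsub h.pos, ae_restrict_mem measurableSet_Ioc]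
    with r h1 h2 h3
  have hS := hψ.area_pos (n - 1) h3.1
  rw [Real.norm_of_nonneg (mul_nonneg hS.le (Real.rpow_nonneg h2.le _)), mul_comm]
  exact mul_le_mul_of_nonneg_right
    (Real.rpow_le_rpow h2.le ((h1 h3.2).trans (le_abs_self C)) hq) hS.le

theorem intervalIntegrable (hq : 0 ≤ q) {R : ℝ} (hR : 0 ≤ R) :
    IntervalIntegrable (fun s => ψ s ^ (n - 1) * f s ^ q) volume 0 R := by
  obtain ⟨C, -, hC⟩ := h.exists_ballMass_integrand_le hψ hq R
  rw [intervalIntegrable_iff_integrableOn_Ioc_of_le hR]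
  have hS : ContinuousOn (fun s => ψ s ^ (n - 1)) (Icc 0 R) :=
    (hψ.continuousOn_pow _).mono Icc_subset_Ici_self
  have hSi : IntegrableOn (fun s => ψ s ^ (n - 1)) (Ioc 0 R) :=
    hS.integrableOn_Icc.mono_set Ioc_subset_Icc_self
  exact (hSi.const_mul C).mono' (hSi.aestronglyMeasurable.mul
    (h.measurable.pow_const q).aestronglyMeasurable) hC

theorem continuousOn_ballMass (hq : 0 ≤ q) : ContinuousOn (ballMass n q ψ f) (Ici 0) := by
  intro r hr
  have h1 := intervalIntegral.continuousOn_primitive_interval'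
    (h.intervalIntegrable hψ hq (add_nonneg hr zero_le_one)) left_mem_uIcc
  rw [uIcc_of_le (add_nonneg hr zero_le_one)] at h1
  refine (h1 r ⟨hr, by linarith⟩).mono_of_mem_nhdsWithin ?_
  rw [← Ici_inter_Iic]
  exact inter_mem_nhdsWithin _ (Iic_mem_nhds (by linarith))

theorem ballMass_nonneg {r : ℝ} (hr : 0 ≤ r) : 0 ≤ ballMass n q ψ f r := by
  rw [ballMass, intervalIntegral.integral_of_le hr]
  refine integral_nonneg_of_ae ?_
  have hsub : Ioc 0 r ⊆ Ioi 0 := Ioc_subset_Ioi_self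
  filter_upwards [ae_restrict_of_ae_restrict_of_subset hsub h.pos,
    ae_restrict_mem measurableSet_Ioc] with s h1 h2
  exact mul_nonneg (hψ.area_pos _ h2.1).le (Real.rpow_nonneg h1.le _)

theorem exists_ballMass_le (hq : 0 ≤ q) (R : ℝ) : ∃ C, ∀ r, 0 ≤ r → r ≤ R →
    ballMass n q ψ f r ≤ C * ballVol n ψ r := by
  obtain ⟨C, -, hC⟩ := h.exists_ballMass_integrand_le hψ hq R
  refine ⟨C, fun r hr hrR => ?_⟩
  rw [ballMass, ballVol, ← intervalIntegral.integral_const_mul,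
    intervalIntegral.integral_of_le hr, intervalIntegral.integral_of_le hr]
  refine integral_mono_ae ((h.intervalIntegrable hψ hq hr).1)
    (((continuousOn_const.mul (hψ.continuousOn_pow _)).intervalIntegrable_of_Ici le_rfl hr).1) ?_
  filter_upwards [ae_restrict_of_ae_restrict_of_subset (Ioc_subset_Ioc_right hrR) hC] with s hs
  exact (le_abs_self _).trans hs

theorem continuousOn_slope (hp : 1 < p) (hq : 0 ≤ q) :
    ContinuousOn (fun r => -(ballMass n q ψ f r / ψ r ^ (n - 1)) ^ (1 / (p - 1))) (Ici 0) := by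
  have ha : 0 ≤ 1 / (p - 1) := one_div_nonneg.2 (by linarith)
  suffices hw : ContinuousOn (fun r => ballMass n q ψ f r / ψ r ^ (n - 1)) (Ici 0) from
    (hw.rpow_const fun _ _ => Or.inr ha).neg
  intro r hr
  rcases (mem_Ici.1 hr).eq_or_lt with rfl | hr
  · obtain ⟨C, hC⟩ := h.exists_ballMass_le hψ hq 1
    have h0 : ballMass n q ψ f 0 / ψ 0 ^ (n - 1) = 0 := by simp [ballMass]
    have hT : Tendsto (fun r => C * Theta n ψ r) (𝓝[Ici 0] 0) (𝓝 0) := by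
      have := (hψ.continuousOn_Theta (n := n) 0 self_mem_Ici).tendsto.const_mul C
      simpa [Theta] using this
    rw [ContinuousWithinAt, h0]
    refine tendsto_of_tendsto_of_tendsto_of_le_of_le' tendsto_const_nhds hT ?_ ?_
    · filter_upwards [self_mem_nhdsWithin] with r hr
      exact div_nonneg (h.ballMass_nonneg hψ hr) (pow_nonneg (hψ.nonneg hr) _)
    · filter_upwards [self_mem_nhdsWithin,
        mem_nhdsWithin_of_mem_nhds (Iic_mem_nhds one_pos)] with r hr hr1
      rw [Theta_eq, ← mul_div_assoc]
      exact div_le_div_of_nonneg_right (hC r hr hr1) (pow_nonneg (hψ.nonneg hr) _)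
  · exact (((h.continuousOn_ballMass hψ hq).continuousAt (Ici_mem_nhds hr)).div
      ((hψ.continuousOn_pow _).continuousAt (Ici_mem_nhds hr))
      (hψ.area_pos _ hr).ne').continuousWithinAt

/-- Domination by `|g|^(p-1) ≤ 1 + |g|^p`; the case `g = 0` is separate because `p - 2` may be
negative. -/
theorem intervalIntegrable_flux (hp : 1 < p) {R : ℝ} (hR : 0 ≤ R) :
    IntervalIntegrable (fun r => ψ r ^ (n - 1) * (|g r| ^ (p - 2) * g r)) volume 0 R := by
  rw [intervalIntegrable_iff_integrableOn_Ioc_of_le hR]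
  have hS : ContinuousOn (fun s => ψ s ^ (n - 1)) (Icc 0 R) :=
    (hψ.continuousOn_pow _).mono Icc_subset_Ici_self
  have hSi : IntegrableOn (fun s => ψ s ^ (n - 1)) (Ioc 0 R) :=
    hS.integrableOn_Icc.mono_set Ioc_subset_Icc_self
  have hm : Measurable fun r => |g r| ^ (p - 2) * g r :=
    ((h.measurable_deriv.abs).pow_const (p - 2)).mul h.measurable_deriv
  refine (hSi.add (h.integrableOn R)).mono'
    (hSi.aestronglyMeasurable.mul hm.aestronglyMeasurable) ?_
  filter_upwards [ae_restrict_mem measurableSet_Ioc] with r hr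
  have hSr := (hψ.area_pos (n - 1) hr.1).le
  rw [norm_mul, Real.norm_of_nonneg hSr, Pi.add_apply, ← mul_one_add]
  refine mul_le_mul_of_nonneg_left ?_ hSr
  rw [norm_mul, Real.norm_of_nonneg (Real.rpow_nonneg (abs_nonneg _) _), Real.norm_eq_abs]
  rcases eq_or_ne (g r) 0 with h0 | h0
  · rw [h0, abs_zero, mul_zero, Real.zero_rpow (by linarith)]
    norm_num
  · have hpos := abs_pos.2 h0
    rw [← Real.rpow_add_one hpos.ne']
    rcases le_total |g r| 1 with h1 | h1
    · have := Real.rpow_le_one hpos.le h1 (show 0 ≤ p - 2 + 1 by linarith)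
      linarith [Real.rpow_nonneg hpos.le p]
    · have := Real.rpow_le_rpow_of_exponent_le h1 (show p - 2 + 1 ≤ p by linarith)
      linarith

/-- The weak equation tested with primitives of `θ`. -/
theorem integral_flux_mul (hp : 1 < p) (hq : 0 ≤ q) {θ : ℝ → ℝ} (hθ : ContDiff ℝ ∞ θ) {a R : ℝ}
    (ha : 0 < a) (hR : 0 ≤ R) (hθa : ∀ t, t < a → θ t = 0) (hθR : ∀ t, R ≤ t → θ t = 0) :
    ∫ r in (0 : ℝ)..R, θ r * (ψ r ^ (n - 1) * (|g r| ^ (p - 2) * g r) + ballMass n q ψ f r) = 0 := by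
  -- Starting the primitive at `R` makes it vanish beyond `R`; it is constant near zero because `θ`
  -- vanishes below `a`.
  set η : ℝ → ℝ := fun r => ∫ s in R..r, θ s with hη
  have hηd : ∀ r, HasDerivAt η (θ r) r := fun r =>
    (hθ.continuous.integral_hasStrictDerivAt R r).hasDerivAt
  have hηd' : deriv η = θ := funext fun r => (hηd r).deriv
  have hηs : ContDiff ℝ ∞ η :=
    contDiff_infty_iff_deriv.2 ⟨fun r => (hηd r).differentiableAt, hηd'.symm ▸ hθ⟩
  have hηR : ∀ t, R ≤ t → η t = 0 := by
    intro t ht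
    refine (intervalIntegral.integral_congr (g := fun _ => 0) fun s hs => ?_).trans (by simp)
    rw [uIcc_of_le ht] at hs
    exact hθR s hs.1
  have hη0 : ∀ᶠ t in 𝓝 0, η t = η 0 := by
    filter_upwards [gt_mem_nhds ha] with t ht
    have h1 : η t - η 0 = ∫ s in (0 : ℝ)..t, θ s :=
      intervalIntegral.integral_interval_sub_left (hθ.continuous.intervalIntegrable _ _)
        (hθ.continuous.intervalIntegrable _ _)
    have h2 : ∫ s in (0 : ℝ)..t, θ s = 0 := by
      refine (intervalIntegral.integral_congr (g := fun _ => 0) fun s hs => ?_).trans (by simp)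
      exact hθa s (hs.2.trans_lt (max_lt ha ht))
    linarith
  have hw := h.weak η hηs hη0 ⟨R, fun t ht => hηR t ht.le⟩
  have hcut : ∀ F : ℝ → ℝ, (∀ r, R ≤ r → F r = 0) → ∫ r in Ioi 0, F r = ∫ r in (0 : ℝ)..R, F r := by
    intro F hF
    rw [intervalIntegral.integral_of_le hR]
    refine setIntegral_eq_of_subset_of_forall_sdiff_eq_zero measurableSet_Ioi Ioc_subset_Ioi_self
      fun r hr => hF r ?_
    by_contra! hlt
    exact hr.2 ⟨hr.1, hlt.le⟩
  rw [hηd', hcut _ fun r hr => by rw [hθR r hr]; simp, hcut _ fun r hr => by rw [hηR r hr]; simp]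
    at hw
  have hint := h.intervalIntegrable hψ hq hR
  -- Here `f` is only measurable, so `m` is merely absolutely continuous. Both boundary terms
  -- vanish, as `m(0) = 0` and `η(R) = 0`.
  have hAC := hint.absolutelyContinuousOnInterval_intervalIntegral (c := 0) left_mem_uIcc
  have hηAC : AbsolutelyContinuousOnInterval η 0 R :=
    ((hηs.of_le (by norm_cast)).contDiffOn (n := 1)).absolutelyContinuousOnInterval
  have hparts := hηAC.integral_mul_deriv_eq_deriv_mul hAC
  rw [hηd', hηR R le_rfl, intervalIntegral.integral_same, zero_mul, mul_zero, sub_zero,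
    zero_sub] at hparts
  have e1 : ∫ r in (0 : ℝ)..R, ψ r ^ (n - 1) * (f r ^ q * η r)
      = ∫ r in (0 : ℝ)..R, η r * deriv (fun r => ∫ s in (0 : ℝ)..r, ψ s ^ (n - 1) * f s ^ q) r := by
    refine intervalIntegral.integral_congr_ae ?_
    filter_upwards [hint.ae_hasDerivAt_integral] with r hr hr0
    rw [(hr (uIoc_subset_uIcc hr0) 0 left_mem_uIcc).deriv]
    ring
  have e2 : ∫ r in (0 : ℝ)..R, θ r * (ψ r ^ (n - 1) * (|g r| ^ (p - 2) * g r))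
      = ∫ r in (0 : ℝ)..R, ψ r ^ (n - 1) * (|g r| ^ (p - 2) * (g r * θ r)) :=
    intervalIntegral.integral_congr fun r _ => by ring
  simp only [mul_add]
  refine (intervalIntegral.integral_add
    ((h.intervalIntegrable_flux hψ hp hR).continuousOn_mul hθ.continuous.continuousOn)
    ((hθ.continuous.continuousOn.mul ((h.continuousOn_ballMass hψ hq).mono
      (by rw [uIcc_of_le hR]; exact Icc_subset_Ici_self))).intervalIntegrable)).trans ?_
  rw [e2, hw, e1, hparts]
  exact neg_add_cancel _

/-- A du Bois-Reymond argument. Test functions need only be constant near the pole, not zero there,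
so `θ` is unrestricted in mean and no integration constant appears. -/
theorem ae_flux_eq (hp : 1 < p) (hq : 0 ≤ q) : ∀ᵐ r, r ∈ Ioi (0 : ℝ) →
    ψ r ^ (n - 1) * (|g r| ^ (p - 2) * g r) + ballMass n q ψ f r = 0 := by
  refine isOpen_Ioi.ae_eq_zero_of_integral_contDiff_smul_eq_zero ?_ ?_
  · refine (locallyIntegrableOn_iff isOpen_Ioi.isLocallyClosed).2 fun K hK0 hK => ?_
    obtain ⟨R, hR, hKR⟩ := hK.isBounded.exists_pos_norm_le
    have hsub : K ⊆ Ioc 0 R := fun r hr => ⟨hK0 hr, (le_abs_self r).trans (hKR r hr)⟩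
    refine IntegrableOn.mono_set ?_ hsub
    rw [← intervalIntegrable_iff_integrableOn_Ioc_of_le hR.le]
    exact (h.intervalIntegrable_flux hψ hp hR.le).add (((h.continuousOn_ballMass hψ hq).mono
      (by rw [uIcc_of_le hR.le]; exact Icc_subset_Ici_self)).intervalIntegrable)
  · intro θ hθ hθc hθs
    obtain ⟨R, hR, hθR⟩ := hθc.isBounded.exists_pos_norm_le
    have hR' : ∀ t, R + 1 ≤ t → θ t = 0 := fun t ht => by
      refine image_eq_zero_of_notMem_tsupport fun hmem => ?_
      have := (le_abs_self t).trans (hθR t hmem)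
      linarith
    obtain ⟨a, ha, hθa⟩ : ∃ a, 0 < a ∧ ∀ t, t < a → θ t = 0 := by
      rcases (tsupport θ).eq_empty_or_nonempty with he | hne
      · refine ⟨1, one_pos, fun t _ => image_eq_zero_of_notMem_tsupport ?_⟩
        rw [he]
        exact notMem_empty t
      · refine ⟨sInf (tsupport θ), hθs (IsCompact.sInf_mem hθc hne), fun t ht => ?_⟩
        exact image_eq_zero_of_notMem_tsupport fun hmem =>
          (csInf_le (IsCompact.bddBelow hθc) hmem).not_gt ht
    have key := h.integral_flux_mul hψ hp hq hθ ha (by linarith : 0 ≤ R + 1) hθa hR'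
    rw [intervalIntegral.integral_of_le (by linarith), setIntegral_eq_integral_of_forall_compl_eq_zero
      fun r hr => ?_] at key
    · simpa using key
    · have : θ r = 0 := by
        by_contra hne
        refine hr ⟨lt_of_not_ge fun h0 => hne (hθa r (h0.trans_lt ha)), le_of_not_gt fun h0 => ?_⟩
        exact hne (hR' r h0.le)
      rw [this, zero_mul]

theorem ae_deriv_eq (hp : 1 < p) (hq : 0 ≤ q) : ∀ᵐ r ∂volume.restrict (Ioi (0 : ℝ)),
    g r = -(ballMass n q ψ f r / ψ r ^ (n - 1)) ^ (1 / (p - 1)) := by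
  rw [ae_restrict_iff' measurableSet_Ioi]
  filter_upwards [h.ae_flux_eq hψ hp hq] with r hr hr0
  have hS := hψ.area_pos (n - 1) hr0
  refine eq_neg_rpow_of_abs_rpow_mul_eq hp (div_nonneg (h.ballMass_nonneg hψ (le_of_lt hr0)) hS.le) ?_
  have := hr hr0
  field_simp
  linarith

end IsWeakProfile

end ModelManifold

/-! ### The continuous representative of a radial weak solution. -/

namespace ModelManifold

variable {n : ℕ} {p q : ℝ} {ψ : ℝ → ℝ} {u : Space n → ℝ}

/-- The gradient of `x ↦ ∫_0^‖x‖ g`, where `g` is continuous and vanishes at the origin. -/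
theorem hasFDerivAt_primitive_norm {g : ℝ → ℝ} (hg : ContinuousOn g (Ici 0)) (hg0 : g 0 = 0)
    (x : Space n) :
    HasFDerivAt (fun x : Space n => ∫ s in (0 : ℝ)..‖x‖, g s)
      (g ‖x‖ • innerSL ℝ (‖x‖⁻¹ • x)) x := by
  rcases eq_or_ne x 0 with rfl | hx
  -- Freezing `g` at `g 0 = 0` for negative arguments gives a two-sided derivative zero, so the
  -- primitive is `o(‖x‖)` at the pole.
  · have h1 : HasDerivAt (fun r => ∫ s in (0 : ℝ)..r, g (max 0 s)) 0 0 := by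
      simpa [hg0] using (hg.comp_max_zero.integral_hasStrictDerivAt 0 0).hasDerivAt
    have h2 : HasDerivAt (fun r => ∫ s in (0 : ℝ)..r, g (max 0 s)) 0 ‖(0 : Space n)‖ := by
      rwa [norm_zero]
    rw [hasDerivAt_iff_isLittleO] at h1
    have hnorm : Tendsto (fun x : Space n => ‖x‖) (𝓝 0) (𝓝 0) := by
      simpa using (continuous_norm (E := Space n)).tendsto 0
    rw [hasFDerivAt_iff_isLittleO]
    have h3 := (h1.comp_tendsto hnorm).norm_right
    refine (h3.congr (fun y => ?_) fun y => ?_).of_norm_right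
    · simp [integral_comp_max_zero g (norm_nonneg y)]
    · simp
  · exact hasFDerivAt_comp_norm hx (hg.hasDerivAt_primitive_Ici (norm_pos_iff.2 hx))

namespace IsWeakProfile

variable {f g : ℝ → ℝ}

/-- The profile of a radial weak solution is, up to a null set, a primitive of its slope. -/
theorem exists_primitive [NeZero n] (h : IsWeakProfile ψ p q u f g)
    (hψ : IsCartanHadamardModel ψ) (hp : 1 < p) (hq : 0 ≤ q) : ∃ c : ℝ, ∀ᵐ x, u x = c
      + ∫ s in (0 : ℝ)..‖x‖, -(ballMass n q ψ f s / ψ s ^ (n - 1)) ^ (1 / (p - 1)) := by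
  set g₀ : ℝ → ℝ := fun s => -(ballMass n q ψ f s / ψ s ^ (n - 1)) ^ (1 / (p - 1)) with hg₀
  have hc : ContinuousOn g₀ (Ici 0) := h.continuousOn_slope hψ hp hq
  have h00 : g₀ 0 = 0 := by
    have : (1 / (p - 1)) ≠ 0 := one_div_ne_zero (by linarith)
    simp only [hg₀, ballMass, intervalIntegral.integral_same, zero_div, Real.zero_rpow this,
      neg_zero]
  have hd := fun x : Space n => hasFDerivAt_primitive_norm hc h00 x
  set W : Space n → ℝ := fun x => ∫ s in (0 : ℝ)..‖x‖, g₀ s with hW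
  have hWd : Differentiable ℝ W := fun x => (hd x).differentiableAt
  have hWl : LocallyIntegrable W := hWd.continuous.locallyIntegrable
  have hgg : ∀ᵐ x : Space n, g ‖x‖ = g₀ ‖x‖ := ae_comp_norm_iff.2 (h.ae_deriv_eq hψ hp hq)
  have hgrad : ∀ v, (fun x : Space n => fderiv ℝ W x v)
      =ᵐ[volume] fun x => inner ℝ (g ‖x‖ • ‖x‖⁻¹ • x) v := by
    intro v
    filter_upwards [hgg] with x hx
    rw [(hd x).fderiv, hx, inner_smul_left]
    rfl
  -- The classical gradient of `W` agrees almost everywhere with the weak gradient of `u`.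
  have hconst := ae_eq_const_of_weak_deriv_zero (h.locallyIntegrable.sub hWl) ?_
  · obtain ⟨c, hcu⟩ := hconst
    refine ⟨c, ?_⟩
    filter_upwards [hcu] with x hx
    rw [← hx, Pi.sub_apply]
    exact (sub_add_cancel _ _).symm
  · intro φ hφ hφc v
    have hφ'c : HasCompactSupport fun x => fderiv ℝ φ x v := hφc.fderiv_apply ℝ v
    have hφ' : Continuous fun x => fderiv ℝ φ x v :=
      (hφ.continuous_fderiv (by simp)).clm_apply continuous_const
    have i1 : Integrable fun x => u x * fderiv ℝ φ x v := by
      simpa [mul_comm] using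
        h.locallyIntegrable.integrable_smul_left_of_hasCompactSupport hφ' hφ'c
    have i2 : Integrable fun x => W x * fderiv ℝ φ x v := by
      simpa [mul_comm] using hWl.integrable_smul_left_of_hasCompactSupport hφ' hφ'c
    have i3 : Integrable fun x => W x * φ x := by
      simpa [mul_comm] using
        hWl.integrable_smul_left_of_hasCompactSupport hφ.continuous hφc
    have i4 : Integrable fun x => fderiv ℝ W x v * φ x := by
      have := (h.locallyIntegrable_grad v).integrable_smul_left_of_hasCompactSupport
        hφ.continuous hφc
      refine this.congr ?_
      filter_upwards [hgrad v] with x hx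
      rw [hx, smul_eq_mul, mul_comm]
    have hparts := integral_mul_fderiv_eq_neg_fderiv_mul_of_integrable i4 i2 i3
      (fun x _ => hWd x) (fun x _ => hφ.differentiable (by simp) x)
    simp only [Pi.sub_apply, sub_mul]
    rw [integral_sub i1 i2, h.weakGradient φ hφ hφc v, hparts, sub_eq_zero, neg_inj]
    refine integral_congr_ae ?_
    filter_upwards [hgrad v] with x hx
    rw [hx]

end IsWeakProfile

/-- Radial weak solutions have a continuous profile, which solves the radial equation. -/
theorem IsRadialSolution.exists_isRadialODESolution [NeZero n] (hψ : IsCartanHadamardModel ψ)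
    (hp : 1 < p) (hq : 0 ≤ q) (hu : IsRadialSolution ψ p q u) :
    ∃ f, IsRadialProfile ψ u f ∧ IsRadialODESolution n p q ψ f := by
  obtain ⟨f₁, g, h⟩ := hu.exists_isWeakProfile hψ hp
  obtain ⟨c, hc⟩ := h.exists_primitive hψ hp hq
  set g₀ : ℝ → ℝ := fun s => -(ballMass n q ψ f₁ s / ψ s ^ (n - 1)) ^ (1 / (p - 1)) with hg₀
  have hg₀c : ContinuousOn g₀ (Ici 0) := h.continuousOn_slope hψ hp hq
  set f : ℝ → ℝ := fun r => c + ∫ s in (0 : ℝ)..r, g₀ s with hf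
  have hfc : ContinuousOn f (Ici 0) := continuousOn_const.add hg₀c.continuousOn_primitive_Ici
  have hff : ∀ᵐ r ∂volume.restrict (Ioi 0), f₁ r = f r := by
    refine (ae_comp_norm_iff (n := n)).1 ?_
    filter_upwards [hc, h.ae_eq] with x h1 h2
    rw [← h2, h1]
  have hmass : ∀ r, 0 ≤ r → ballMass n q ψ f₁ r = ballMass n q ψ f r := by
    intro r hr
    rw [ballMass, ballMass, intervalIntegral.integral_of_le hr, intervalIntegral.integral_of_le hr]
    refine integral_congr_ae ?_
    have hsub : Ioc 0 r ⊆ Ioi 0 := Ioc_subset_Ioi_self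
    filter_upwards [ae_restrict_of_ae_restrict_of_subset hsub hff] with s hs
    rw [hs]
  have hfd : ∀ r, 0 < r → HasDerivAt f (g₀ r) r := fun r hr =>
    (hg₀c.hasDerivAt_primitive_Ici hr).const_add c
  have hanti : AntitoneOn f (Ici 0) :=
    antitoneOn_Ici_of_hasDerivAt_nonpos hfc hfd fun r hr => neg_nonpos.2
      (Real.rpow_nonneg (div_nonneg (h.ballMass_nonneg hψ hr.le) (hψ.area_pos _ hr).le) _)
  refine ⟨f, ⟨hfc, hψ.ae_vol_iff.2 hc⟩, hfc, fun r hr => ?_, fun r hr => ?_⟩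
  -- Positivity is known only almost everywhere; some `s > r` has `f s > 0`, and `f` is
  -- nonincreasing.
  · have hsub : Ioi r ⊆ Ioi (0 : ℝ) := Ioi_subset_Ioi hr
    have : (ae (volume.restrict (Ioi r))).NeBot := by
      rw [ae_neBot, Ne, Measure.restrict_eq_zero, Real.volume_Ioi]
      exact ENNReal.top_ne_zero
    obtain ⟨s, h1, h2, h3⟩ := ((ae_restrict_of_ae_restrict_of_subset hsub hff).and
      ((ae_restrict_of_ae_restrict_of_subset hsub h.pos).and
        (ae_restrict_mem measurableSet_Ioi))).exists
    rw [h1] at h2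
    exact h2.trans_le (hanti hr (hr.trans (le_of_lt h3)) (le_of_lt h3))
  · rw [← hmass r hr.le]
    exact hfd r hr

end ModelManifold
end

theorem mainTheorem4 (n : ℕ) (p q : ℝ) (hp : 1 < p) (hpn : p < n)
    (hq : n * p / (n - p) - 1 ≤ q) (ψ : ℝ → ℝ) (hψ : ModelManifold.IsCartanHadamardModel ψ)
    (u : ModelManifold.Space n → ℝ) (hu : ModelManifold.IsRadialSolution ψ p q u) :
    ∃ f : ℝ → ℝ, ModelManifold.IsRadialProfile ψ u f ∧
      (ModelManifold.PStochasticallyComplete n ψ p →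
        (ModelManifold.StretchedExponentialGrowth ψ ∨ ModelManifold.SuperExponentialGrowth ψ) →
        Tendsto
          (fun r : ℝ =>
            (∫ s in (0 : ℝ)..r, ModelManifold.Theta n ψ s ^ (1 / (p - 1)))
              ^ ((p - 1) / (q + 1 - p)) * f r)
          atTop (𝓝 (((p - 1) / (q + 1 - p)) ^ ((p - 1) / (q + 1 - p))))) ∧
      (ModelManifold.PStochasticallyIncomplete n ψ p →
        ∃ l : ℝ, 0 < l ∧ Tendsto f atTop (𝓝 l) ∧
          Tendsto
            (fun r : ℝ =>
              (∫ s in Ioi r, ModelManifold.Theta n ψ s ^ (1 / (p - 1)))⁻¹ * (f r - l))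
            atTop (𝓝 (l ^ (q / (p - 1)))) ∧
          l ≤ ((p - 1) / (q + 1 - p)) ^ ((p - 1) / (q + 1 - p))
            * (∫ s in Ioi (0 : ℝ), ModelManifold.Theta n ψ s ^ (1 / (p - 1)))
              ^ (-((p - 1) / (q + 1 - p)))) := by
  have hn : 2 ≤ n := by
    have : (1 : ℝ) < n := hp.trans hpn
    exact_mod_cast this
  have : NeZero n := ⟨by omega⟩
  have hnp : 0 < (n : ℝ) - p := sub_pos.2 hpn
  have hp0 : 0 < p := by linarith
  have hn0 : (0 : ℝ) < n := hp0.trans hpn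
  have hq1 : n * p / (n - p) ≤ q + 1 := by linarith
  have hpq : p < q + 1 := by
    refine lt_of_lt_of_le ?_ hq1
    rw [lt_div_iff₀ hnp]
    nlinarith
  -- The condition `q + 1 ≥ p*` in reciprocal form, since `1/p* = 1/p - 1/n`.
  have hcrit : 1 / (n : ℝ) ≤ 1 / p - 1 / (q + 1) := by
    have h1 : 1 / (q + 1) ≤ 1 / (n * p / (n - p)) := one_div_le_one_div_of_le (by positivity) hq1
    have h2 : 1 / (n * p / (n - p)) = 1 / p - 1 / (n : ℝ) := by
      field_simp
    linarith
  obtain ⟨f, hfu, hf⟩ := hu.exists_isRadialODESolution hψ hp (by linarith)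
  exact ⟨f, hfu, hf.asymptotics_of_complete hψ hn hp hpq hcrit,
    hf.asymptotics_of_incomplete hψ hn hp hpq hcrit⟩
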